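/- Let $\mathbb{N}=\{1,2,3,\dots\}$, $\mathbb{K}=\mathbb{R}$ or $\mathbb{C}$, $1\le p<\infty$ and $N\ge 2$; write $[l]=\{1,\dots,l\}$. For each $s\in[N]$ let $f_s:\mathbb{N}\to\mathbb{N}$ be strictly increasing with $f_s(1)>1$, let $(w_{s,j})_{j\ge 1}$ be a sequence in $\mathbb{K}$ with $\sup_j|w_{s,f_s(j)}|<\infty$, and let $T_s$ be the unilateral pseudo-shift on $\ell^p(\mathbb{N})$ (over $\mathbb{K}$) given by $$T_s\Big(\sum_{j\ge1}x_je_j\Big)=\sum_{j\ge1}w_{s,f_s(j)}\,x_{f_s(j)}\,e_j .$$ Put $W^s_{l,n}=\prod_{\nu=1}^{n}w_{s,f_s^{\nu}(l)}$, where $f_s^\nu$ is the $\nu$-th iterate of $f_s$, and let $f_s^{-n}$ be the inverse of the injective map $f_s^n$ on its range. Let $\mathcal{A}$ be either the family $\mathcal{A}_{uBd}$ of all sets $A\subseteq\{0,1,2,\dots\}$ with positive upper Banach density $\limsup_{M\to\infty}\max_{k\ge1}\frac{\mathrm{card}(A\cap[k+1,k+M])}{M}$, or the family $\mathcal{A}_{ud}$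 of all such sets with positive upper density $\limsup_{M\to\infty}\frac{\mathrm{card}\{n\in A:\,n\le M\}}{M}$. Suppose that $\mathcal{A}$ is $(f_s)_{s=1}^N$-almost partition regular: for every $l\ge1$ and every $B\in\mathcal{A}$ there is $A\in\mathcal{A}$ with $A\subseteq B$ such that $f_s^m([l])\cap f_t^n([l])=\emptyset$ for all $m\ne n$ in $A$ and all $s,t\in[N]$. Then $T_1,\dots,T_N$ are disjoint $\mathcal{A}$-hypercyclic (that is, there is $x\in\ell^p(\mathbb{N})$ such that $\{n\ge0:(T_1^nx,\dots,T_N^nx)\in U\}\in\mathcal{A}$ for every nonempty open set $U\subseteq\ell^p(\mathbb{N})^N$) if and only if both of the following conditions hold. (1) For every $j\ge1$ and every $s\in[N]$, $\displaystyle\sum_{n\ge1}\frac{1}{|W^s_{j,n}|^p}<\infty$ (with $1/0=\infty$, so that in particular all $W^s_{j,n}$ are nonzero). (2) For every $l\ge1$, every family $(a_{s,j})_{s\in[N],\,j\in[l]}$ of nonzero elements of $\mathbb{K}$ and every $\varepsilon>0$ there exists $A\in\mathcal{A}$ such that for all $s\ne t$ in $[N]$ and all $n\in A$: (a) for every $1\le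 j\le l$, $$\sum_{m\in A:\ f_t^m(j)\in f_s^n((l,\infty))}\frac{|W^s_{f_s^{-n}(f_t^m(j)),\,n}|^p}{|W^t_{j,m}|^p}\le\varepsilon ;$$ (b) for every $j\in f_t^n([l])\cap f_s^n([l])$, $$\left|\frac{W^s_{f_s^{-n}(j),\,n}}{W^t_{f_t^{-n}(j),\,n}}-\frac{a_{s,f_s^{-n}(j)}}{a_{t,f_t^{-n}(j)}}\right|\le\varepsilon .$$ -/

import Mathlib

open scoped ENNReal

namespace DisjointDynamics

/-! ### Densities of sets of natural numbers -/

/-- The upper density `limsup_N card {n ∈ A | n ≤ N} / N`. -/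
noncomputable def upperDensity (A : Set ℕ) : ℝ :=
  Filter.limsup (fun N : ℕ => ({n ∈ A | n ≤ N}.ncard : ℝ) / N) Filter.atTop

/-- The upper Banach density `limsup_N sup_{k ≥ 1} card (A ∩ [k + 1, k + N]) / N`. -/
noncomputable def upperBanachDensity (A : Set ℕ) : ℝ :=
  Filter.limsup
    (fun N : ℕ => ⨆ k : ℕ+, ((A ∩ Set.Icc ((k : ℕ) + 1) (k + N)).ncard : ℝ) / N) Filter.atTop

/-- The family of sets of positive upper density. -/
def posUpperDensity : Set (Set ℕ) := {A | 0 < upperDensity A}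

/-- The family of sets of positive upper Banach density. -/
def posUpperBanachDensity : Set (Set ℕ) := {A | 0 < upperBanachDensity A}

/-! ### Hypercyclicity along a family of sets -/

section Hypercyclicity

variable {𝕜 X : Type*} [NontriviallyNormedField 𝕜] [AddCommGroup X] [Module 𝕜 X]
  [TopologicalSpace X]

/-- `x` is an `𝒜`-hypercyclic vector for `T`: every nonempty open set is visited by the orbit of
`x` along a set of times belonging to `𝒜`. -/
def IsHypercyclicVector (𝒜 : Set (Set ℕ)) (T : X →L[𝕜] X) (x : X) : Prop :=
  ∀ U : Set X, IsOpen U → U.Nonempty → {n : ℕ | (T ^ n) x ∈ U} ∈ 𝒜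

/-- `T_1, …, T_N` are disjoint `𝒜`-hypercyclic: the direct sum operator on `X ^ N` has an
`𝒜`-hypercyclic vector on the diagonal. -/
def DisjointHypercyclic (𝒜 : Set (Set ℕ)) {N : ℕ} (T : Fin N → X →L[𝕜] X) : Prop :=
  ∃ x : X, IsHypercyclicVector 𝒜 (ContinuousLinearMap.piMap T) (fun _ : Fin N => x)

end Hypercyclicity

/-- `𝒜` is `(f_s)`-almost partition regular. Here `Set.Iic l` is `[l] = {1, …, l}`. -/
def AlmostPartitionRegular {N : ℕ} (f : Fin N → ℕ+ → ℕ+) (𝒜 : Set (Set ℕ)) : Prop :=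
  ∀ l : ℕ+, ∀ B ∈ 𝒜, ∃ A ∈ 𝒜, A ⊆ B ∧
    ∀ m ∈ A, ∀ n ∈ A, m ≠ n → ∀ s t : Fin N,
      Disjoint ((f s)^[m] '' Set.Iic l) ((f t)^[n] '' Set.Iic l)

/-! ### Unilateral pseudo-shifts -/

/-- The data `(f, w)` of a unilateral pseudo-shift. The bound on the weights is exactly what makes
the operator well defined and bounded on `ℓ^p`. -/
structure PseudoShift (𝕜 : Type*) [RCLike 𝕜] where
  /-- the inducing map `f` -/
  f : ℕ+ → ℕ+
  /-- the weight sequence `w` -/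
  w : ℕ+ → 𝕜
  strictMono : StrictMono f
  one_lt : 1 < f 1
  bounded : ∃ C : ℝ, ∀ j, ‖w (f j)‖ ≤ C

namespace PseudoShift

variable {𝕜 : Type*} [RCLike 𝕜]

lemma sum_rpow_le (S : PseudoShift 𝕜) (p : ℝ≥0∞) [Fact (1 ≤ p)] (hp : p ≠ ∞) {C : ℝ}
    (hC : ∀ j, ‖S.w (S.f j)‖ ≤ C) (x : lp (fun _ : ℕ+ => 𝕜) p) (F : Finset ℕ+) :
    ∑ j ∈ F, ‖S.w (S.f j) * x (S.f j)‖ ^ p.toReal ≤ (C * ‖x‖) ^ p.toReal := by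
  have hp0 : 0 < p.toReal := ENNReal.toReal_pos (one_pos.trans_le Fact.out).ne' hp
  have hC0 : 0 ≤ C := (norm_nonneg _).trans (hC 1)
  calc ∑ j ∈ F, ‖S.w (S.f j) * x (S.f j)‖ ^ p.toReal
      ≤ ∑ j ∈ F, C ^ p.toReal * ‖x (S.f j)‖ ^ p.toReal := by
        refine Finset.sum_le_sum fun j _ => ?_
        rw [norm_mul, Real.mul_rpow (norm_nonneg _) (norm_nonneg _)]
        gcongr
        exact hC j
    _ = C ^ p.toReal * ∑ k ∈ F.image S.f, ‖x k‖ ^ p.toReal := by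
        rw [Finset.sum_image S.strictMono.injective.injOn, Finset.mul_sum]
    _ ≤ C ^ p.toReal * ‖x‖ ^ p.toReal := by
        gcongr
        exact lp.sum_rpow_le_norm_rpow hp0 x _
    _ = (C * ‖x‖) ^ p.toReal := (Real.mul_rpow hC0 (norm_nonneg _)).symm

lemma memℓp (S : PseudoShift 𝕜) (p : ℝ≥0∞) [Fact (1 ≤ p)] (hp : p ≠ ∞)
    (x : lp (fun _ : ℕ+ => 𝕜) p) :
    Memℓp (fun j => S.w (S.f j) * x (S.f j)) p := by
  obtain ⟨C, hC⟩ := S.bounded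
  exact memℓp_gen' fun F => S.sum_rpow_le p hp hC x F

/-- The unilateral pseudo-shift `T x = ∑_j w_{f(j)} x_{f(j)} e_j` on `ℓ^p(ℕ)`, as a continuous
linear operator. -/
noncomputable def op (S : PseudoShift 𝕜) (p : ℝ≥0∞) [Fact (1 ≤ p)] (hp : p ≠ ∞) :
    lp (fun _ : ℕ+ => 𝕜) p →L[𝕜] lp (fun _ : ℕ+ => 𝕜) p :=
  LinearMap.mkContinuousOfExistsBound
    { toFun := fun x => ⟨fun j => S.w (S.f j) * x (S.f j), S.memℓp p hp x⟩
      map_add' := fun x y => by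
        ext j
        exact mul_add _ _ _
      map_smul' := fun c x => by
        ext j
        exact mul_left_comm _ _ _ }
    (by
      obtain ⟨C, hC⟩ := S.bounded
      have hC0 : 0 ≤ C := (norm_nonneg _).trans (hC 1)
      exact ⟨C, fun x => lp.norm_le_of_forall_sum_le
        (ENNReal.toReal_pos (one_pos.trans_le Fact.out).ne' hp)
        (mul_nonneg hC0 (norm_nonneg x)) fun F => S.sum_rpow_le p hp hC x F⟩)

lemma op_apply (S : PseudoShift 𝕜) (p : ℝ≥0∞) [Fact (1 ≤ p)] (hp : p ≠ ∞)
    (x : lp (fun _ : ℕ+ => 𝕜) p) (j : ℕ+) :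
    S.op p hp x j = S.w (S.f j) * x (S.f j) := rfl

/-- The weight products `W_{l, n} = ∏_{ν = 1}^n w_{f^ν(l)}`. -/
def W (S : PseudoShift 𝕜) (l : ℕ+) (n : ℕ) : 𝕜 :=
  ∏ ν ∈ Finset.Icc 1 n, S.w (S.f^[ν] l)

/-- The inverse `f^{-n}` of the injective map `f^n`, used only on the range of `f^n`. -/
noncomputable def fInv (S : PseudoShift 𝕜) (n : ℕ) : ℕ+ → ℕ+ :=
  Function.invFun (S.f^[n])

lemma fInv_iterate (S : PseudoShift 𝕜) (n : ℕ) (i : ℕ+) : S.fInv n (S.f^[n] i) = i :=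
  Function.leftInverse_invFun (S.strictMono.injective.iterate n) i

end PseudoShift

end DisjointDynamics

open DisjointDynamics

namespace DisjointDynamics

/-! ### Windows and densities -/

/-! Necessity. Let `x` be a disjoint hypercyclic vector. If `T_s^n x` is close to `y_s = ∑_{j ≤ l}
a_{s,j} e_j` for all `n ∈ A`, then `W^s_{j,n} x_{f_s^n(j)}` is close to `a_{s,j}`. At a common
position the unknown coordinate of `x` cancels in a quotient, which is (b). The coordinates of
`T_s^n x` beyond `l` have small `p`-norm, while the coordinates of `x` at the positions `f_t^m(j)`,
`m ∈ A`, are bounded below by a multiple of `1/|W^t_{j,m}|`; this is (a). For (1) the same argument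
with a single operator only bounds the sums of `1/|W_{j,g}|^p` over the return times `g` with `n + g
∈ A`. Averaging over `n ∈ A` replaces them by a set of `g` with bounded gaps, and boundedness of the
weights fills the gaps (`summable_of_sum_return_le`).

Sufficiency. For a finite `F ⊆ A`, place `a_{s,j}/W^s_{j,n}` at position `f_s^n(j)` for `n ∈ F`.
Separation prevents collisions between different times, (b) makes collisions at one time harmless,
and (a) together with the tails of (1) bounds the unwanted coordinates (`exists_block_vector`). By
(1) the vector is small when `F` lies far out. Since membership in either family is detected by
finite blocks, countably many such vectors can be added up to treat a countable family of targets
simultaneously (`exists_common_orbit`). -/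

theorem mem_posUpperDensity_iff {A : Set ℕ} :
    A ∈ posUpperDensity ↔ ∃ δ : ℝ, 0 < δ ∧ ∀ M : ℕ, ∃ L : ℕ, M ≤ L ∧ 0 < L ∧
      δ * L ≤ (A ∩ Set.Ioc M L).ncard := by
  have hcard : ∀ L : ℕ, {n ∈ A | n ≤ L}.ncard ≤ L + 1 := fun L => by
    calc {n ∈ A | n ≤ L}.ncard ≤ (Set.Iic L).ncard :=
          Set.ncard_le_ncard (fun n hn => hn.2) (Set.finite_Iic L)
      _ = L + 1 := by rw [Set.ncard_eq_toFinset_card']; simp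
  have hb : ∀ L : ℕ, ({n ∈ A | n ≤ L}.ncard : ℝ) / L ≤ 2 := fun L => by
    rcases Nat.eq_zero_or_pos L with rfl | hL
    · simp
    · have h1 : (1 : ℝ) ≤ L := by exact_mod_cast hL
      rw [div_le_iff₀ (by linarith)]
      have : ({n ∈ A | n ≤ L}.ncard : ℝ) ≤ L + 1 := by exact_mod_cast hcard L
      linarith
  constructor
  · intro h
    obtain ⟨δ, hδ, hδA⟩ := exists_between (show 0 < upperDensity A from h)
    have hf := Filter.frequently_lt_of_lt_limsup (f := Filter.atTop)
      (Filter.isCoboundedUnder_le_of_le Filter.atTop (x := 0) fun L => by positivity) hδA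
    -- Discarding `[0, M]` costs at most `M + 1` elements, which is at most half of `δ * L` once `L
    -- ≥ 2 (M + 1) / δ`.
    refine ⟨δ / 2, by positivity, fun M => ?_⟩
    obtain ⟨L, hL, hLδ⟩ := Filter.frequently_atTop.1 hf (max (max M 1) ⌈2 * (M + 1) / δ⌉₊)
    have hM : M ≤ L := ((le_max_left _ _).trans (le_max_left _ _)).trans hL
    have hL1 : 0 < L := ((le_max_right _ _).trans (le_max_left _ _)).trans hL
    have hL2 : 2 * ((M : ℝ) + 1) / δ ≤ L := Nat.ceil_le.1 ((le_max_right _ _).trans hL)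
    have hL1' : (0 : ℝ) < L := by exact_mod_cast hL1
    refine ⟨L, hM, hL1, ?_⟩
    rw [lt_div_iff₀ hL1'] at hLδ
    rw [div_le_iff₀ hδ] at hL2
    have hsub : {n ∈ A | n ≤ L} ⊆ (A ∩ Set.Ioc M L) ∪ Set.Iic M := fun n hn => by
      rcases le_or_gt n M with h | h
      · exact Or.inr h
      · exact Or.inl ⟨hn.1, h, hn.2⟩
    have h2 : {n ∈ A | n ≤ L}.ncard ≤ (A ∩ Set.Ioc M L).ncard + (M + 1) := by
      refine (Set.ncard_le_ncard hsub (((Set.finite_Ioc M L).inter_of_right A).union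
        (Set.finite_Iic M))).trans ((Set.ncard_union_le _ _).trans ?_)
      gcongr
      rw [Set.ncard_eq_toFinset_card']; simp
    have h3 : ({n ∈ A | n ≤ L}.ncard : ℝ) ≤ (A ∩ Set.Ioc M L).ncard + (M + 1) := by
      exact_mod_cast h2
    linarith
  · rintro ⟨δ, hδ, h⟩
    refine hδ.trans_le (Filter.le_limsup_of_frequently_le (Filter.frequently_atTop.2 fun M => ?_)
      (Filter.isBoundedUnder_of ⟨2, hb⟩))
    obtain ⟨L, hM, hL, hδL⟩ := h M
    refine ⟨L, hM, ?_⟩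
    rw [le_div_iff₀ (by exact_mod_cast hL)]
    refine hδL.trans ?_
    have hsub : A ∩ Set.Ioc M L ⊆ {n ∈ A | n ≤ L} := fun n hn => ⟨hn.1, hn.2.2⟩
    exact_mod_cast Set.ncard_le_ncard hsub ((Set.finite_Iic L).subset fun n hn => hn.2)

theorem mem_posUpperBanachDensity_iff {A : Set ℕ} :
    A ∈ posUpperBanachDensity ↔ ∃ δ : ℝ, 0 < δ ∧ ∀ M : ℕ, ∃ k L : ℕ, M ≤ k ∧ M ≤ L ∧ 0 < L ∧
      δ * L ≤ (A ∩ Set.Ioc k (k + L)).ncard := by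
  have hIcc : ∀ k L : ℕ, Set.Icc (k + 1) (k + L) = Set.Ioc k (k + L) := fun k L => by
    ext; simp
  have hcard : ∀ k L : ℕ, (A ∩ Set.Ioc k (k + L)).ncard ≤ L := fun k L => by
    calc (A ∩ Set.Ioc k (k + L)).ncard ≤ (Set.Ioc k (k + L)).ncard :=
          Set.ncard_le_ncard Set.inter_subset_right (Set.finite_Ioc _ _)
      _ = L := by rw [Set.ncard_eq_toFinset_card']; simp
  have hb : ∀ (L : ℕ) (k : ℕ+),
      ((A ∩ Set.Icc ((k : ℕ) + 1) (k + L)).ncard : ℝ) / L ≤ 1 := fun L k => by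
    rw [hIcc]
    exact div_le_one_of_le₀ (by exact_mod_cast hcard k L) (Nat.cast_nonneg L)
  have hbdd : ∀ L : ℕ, BddAbove (Set.range fun k : ℕ+ =>
      ((A ∩ Set.Icc ((k : ℕ) + 1) (k + L)).ncard : ℝ) / L) := fun L =>
    ⟨1, by rintro _ ⟨k, rfl⟩; exact hb L k⟩
  constructor
  · intro h
    obtain ⟨δ, hδ, hδA⟩ := exists_between (show 0 < upperBanachDensity A from h)
    have hf := Filter.frequently_lt_of_lt_limsup (f := Filter.atTop)
      (Filter.isCoboundedUnder_le_of_le Filter.atTop (x := 0) fun L =>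
        Real.iSup_nonneg fun k => by positivity) hδA
    refine ⟨δ / 2, by positivity, fun M => ?_⟩
    obtain ⟨L, hL, hLδ⟩ := Filter.frequently_atTop.1 hf (max (max M 1) ⌈2 * M / δ⌉₊)
    have hM : M ≤ L := ((le_max_left _ _).trans (le_max_left _ _)).trans hL
    have hL1 : 0 < L := ((le_max_right _ _).trans (le_max_left _ _)).trans hL
    have hL2 : 2 * (M : ℝ) / δ ≤ L := Nat.ceil_le.1 ((le_max_right _ _).trans hL)
    have hL1' : (0 : ℝ) < L := by exact_mod_cast hL1
    obtain ⟨k, hk⟩ := exists_lt_of_lt_ciSup hLδ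
    -- Moving the window to the right by `M` loses at most `M ≤ δ * L / 2` elements.
    refine ⟨k + M, L, Nat.le_add_left _ _, hM, hL1, ?_⟩
    rw [hIcc, lt_div_iff₀ hL1'] at hk
    rw [div_le_iff₀ hδ] at hL2
    have hsub : A ∩ Set.Ioc (k : ℕ) (k + L) ⊆
        (A ∩ Set.Ioc (k + M : ℕ) (k + M + L)) ∪ Set.Ioc (k : ℕ) (k + M) := fun n hn => by
      rcases le_or_gt n (k + M) with h | h
      · exact Or.inr ⟨hn.2.1, h⟩
      · exact Or.inl ⟨hn.1, h, hn.2.2.trans (by omega)⟩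
    have h2 : (A ∩ Set.Ioc (k : ℕ) (k + L)).ncard ≤
        (A ∩ Set.Ioc (k + M : ℕ) (k + M + L)).ncard + M := by
      refine (Set.ncard_le_ncard hsub (((Set.finite_Ioc _ _).inter_of_right A).union
        (Set.finite_Ioc _ _))).trans ((Set.ncard_union_le _ _).trans ?_)
      gcongr
      rw [Set.ncard_eq_toFinset_card']; simp
    have h3 : ((A ∩ Set.Ioc (k : ℕ) (k + L)).ncard : ℝ) ≤
        (A ∩ Set.Ioc (k + M : ℕ) (k + M + L)).ncard + M := by exact_mod_cast h2
    linarith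
  · rintro ⟨δ, hδ, h⟩
    refine hδ.trans_le (Filter.le_limsup_of_frequently_le (Filter.frequently_atTop.2 fun M => ?_)
      (Filter.isBoundedUnder_of ⟨1, fun L => ciSup_le (hb L)⟩))
    -- `M + 1` rather than `M` forces `k ≥ 1`, as the supremum over `ℕ+` requires.
    obtain ⟨k, L, hk, hM, hL, hδL⟩ := h (M + 1)
    refine ⟨L, by omega, le_ciSup_of_le (hbdd L) ⟨k, by omega⟩ ?_⟩
    rw [le_div_iff₀ (by exact_mod_cast hL), hIcc]
    exact hδL

theorem posUpperDensity_subset : posUpperDensity ⊆ posUpperBanachDensity := by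
  intro A hA
  obtain ⟨δ, hδ, h⟩ := mem_posUpperDensity_iff.1 hA
  refine mem_posUpperBanachDensity_iff.2 ⟨δ, hδ, fun M => ?_⟩
  obtain ⟨L, hM, hL, hδL⟩ := h M
  refine ⟨M, L, le_rfl, hM, hL, hδL.trans ?_⟩
  exact_mod_cast Set.ncard_le_ncard
    (Set.inter_subset_inter_right A (Set.Ioc_subset_Ioc_right (Nat.le_add_left L M)))
    ((Set.finite_Ioc _ _).inter_of_right A)

/-- Both families are determined by finite windows: a set belongs to the family as soon as it
contains sufficiently dense finite blocks arbitrarily far out. -/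
theorem exists_block_criterion {𝒜 : Set (Set ℕ)}
    (h𝒜 : 𝒜 = posUpperBanachDensity ∨ 𝒜 = posUpperDensity) :
    ∃ Blk : ℝ → ℕ → Finset ℕ → Prop,
      (∀ A ∈ 𝒜, ∃ δ : ℝ, 0 < δ ∧ ∀ M, ∃ F : Finset ℕ, ↑F ⊆ A ∧ (∀ n ∈ F, M < n) ∧ Blk δ M F) ∧
      ∀ A : Set ℕ, ∀ δ : ℝ, 0 < δ →
        (∀ M₀, ∃ M, M₀ ≤ M ∧ ∃ F : Finset ℕ, ↑F ⊆ A ∧ Blk δ M F) → A ∈ 𝒜 := by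
  rcases h𝒜 with rfl | rfl
  · refine ⟨fun δ M F => ∃ k L : ℕ, M ≤ k ∧ M ≤ L ∧ 0 < L ∧ (↑F : Set ℕ) ⊆ Set.Ioc k (k + L) ∧
      δ * L ≤ F.card, fun A hA => ?_, fun A δ hδ h => ?_⟩
    · obtain ⟨δ, hδ, h⟩ := mem_posUpperBanachDensity_iff.1 hA
      refine ⟨δ, hδ, fun M => ?_⟩
      obtain ⟨k, L, hk, hM, hL, hδL⟩ := h M
      have hfin := (Set.finite_Ioc k (k + L)).inter_of_right A
      refine ⟨hfin.toFinset, by simp, fun n hn => ?_, k, L, hk, hM, hL, by simp, ?_⟩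
      · exact hk.trans_lt (hfin.mem_toFinset.1 hn).2.1
      · rwa [← Set.ncard_eq_toFinset_card _ hfin]
    · refine mem_posUpperBanachDensity_iff.2 ⟨δ, hδ, fun M₀ => ?_⟩
      obtain ⟨M, hM, F, hFA, k, L, hk, hML, hL, hF, hδL⟩ := h M₀
      refine ⟨k, L, hM.trans hk, hM.trans hML, hL, hδL.trans ?_⟩
      rw [← Set.ncard_coe_finset]
      exact_mod_cast Set.ncard_le_ncard (Set.subset_inter hFA hF)
        ((Set.finite_Ioc _ _).inter_of_right A)
  · refine ⟨fun δ M F => ∃ L : ℕ, M ≤ L ∧ 0 < L ∧ (↑F : Set ℕ) ⊆ Set.Ioc M L ∧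
      δ * L ≤ F.card, fun A hA => ?_, fun A δ hδ h => ?_⟩
    · obtain ⟨δ, hδ, h⟩ := mem_posUpperDensity_iff.1 hA
      refine ⟨δ, hδ, fun M => ?_⟩
      obtain ⟨L, hM, hL, hδL⟩ := h M
      have hfin := (Set.finite_Ioc M L).inter_of_right A
      refine ⟨hfin.toFinset, by simp, fun n hn => ?_, L, hM, hL, by simp, ?_⟩
      · exact (hfin.mem_toFinset.1 hn).2.1
      · rwa [← Set.ncard_eq_toFinset_card _ hfin]
    · refine mem_posUpperDensity_iff.2 ⟨δ, hδ, fun M₀ => ?_⟩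
      obtain ⟨M, hM, F, hFA, L, hML, hL, hF, hδL⟩ := h M₀
      refine ⟨L, hM.trans hML, hL, hδL.trans ?_⟩
      rw [← Set.ncard_coe_finset]
      exact_mod_cast Set.ncard_le_ncard
        (Set.subset_inter hFA (hF.trans (Set.Ioc_subset_Ioc_left hM)))
        ((Set.finite_Ioc _ _).inter_of_right A)

/-! ### Return times of a set of positive upper Banach density -/

open Finset in
theorem card_filter_shift_le (P : ℕ → Prop) [DecidablePred P] (k L a : ℕ) :
    #{n ∈ Ioc k (k + L) | P (n + a)} ≤ #{n ∈ Ioc k (k + L) | P n} + a := by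
  calc #{n ∈ Ioc k (k + L) | P (n + a)}
      = #({n ∈ Ioc k (k + L) | P (n + a)}.image (· + a)) :=
        (card_image_of_injective _ (add_left_injective a)).symm
    _ ≤ #({n ∈ Ioc k (k + L) | P n} ∪ Ioc (k + L) (k + L + a)) := by
        refine card_le_card fun m hm => ?_
        simp only [mem_image, mem_filter, mem_Ioc, mem_union] at hm ⊢
        obtain ⟨n, ⟨⟨h1, h2⟩, h3⟩, rfl⟩ := hm
        rcases le_or_gt (n + a) (k + L) with h | h
        · exact Or.inl ⟨⟨by omega, h⟩, h3⟩
        · exact Or.inr ⟨h, by omega⟩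
    _ ≤ _ := (card_union_le _ _).trans (by simp)

open Finset in
theorem card_filter_le_shift (P : ℕ → Prop) [DecidablePred P] (k L a : ℕ) :
    #{n ∈ Ioc k (k + L) | P n} ≤ #{n ∈ Ioc k (k + L) | P (n + a)} + a := by
  calc #{n ∈ Ioc k (k + L) | P n}
      ≤ #({n ∈ Ioc k (k + L) | P (n + a)}.image (· + a) ∪ Ioc k (k + a)) := by
        refine card_le_card fun m hm => ?_
        simp only [mem_image, mem_filter, mem_Ioc, mem_union] at hm ⊢
        rcases le_or_gt m (k + a) with h | h
        · exact Or.inr ⟨hm.1.1, h⟩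
        · have hma : m - a + a = m := by omega
          exact Or.inl ⟨m - a, ⟨⟨by omega, by omega⟩, by rw [hma]; exact hm.2⟩, hma⟩
    _ ≤ #({n ∈ Ioc k (k + L) | P (n + a)}.image (· + a)) + #(Ioc k (k + a)) := card_union_le _ _
    _ = _ := by rw [card_image_of_injective _ (add_left_injective a)]; simp

/-- Along suitable windows all the densities of the sets `A ∩ (A - g)` exist. -/
theorem exists_windows {A : Set ℕ} [DecidablePred (· ∈ A)] (hA : A ∈ posUpperBanachDensity) :
    ∃ (δ : ℝ) (k L : ℕ → ℕ) (d : ℕ → ℝ), 0 < δ ∧ δ ≤ d 0 ∧ (∀ i, 0 < L i) ∧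
      Filter.Tendsto L Filter.atTop Filter.atTop ∧
      ∀ g, Filter.Tendsto (fun i => (((Finset.Ioc (k i) (k i + L i)).filter
        fun n => n ∈ A ∧ n + g ∈ A).card : ℝ) / L i) Filter.atTop (nhds (d g)) := by
  obtain ⟨δ, hδ, h⟩ := mem_posUpperBanachDensity_iff.1 hA
  choose k L _ hL hL0 hd using h
  set ρ : ℕ → ℕ → ℝ := fun i g => (((Finset.Ioc (k i) (k i + L i)).filter
        fun n => n ∈ A ∧ n + g ∈ A).card : ℝ) / L i
  have hρ : ∀ i, ρ i ∈ Set.pi Set.univ fun _ : ℕ => Set.Icc (0 : ℝ) 1 := fun i g _ => by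
    refine ⟨by positivity, div_le_one_of_le₀ ?_ (Nat.cast_nonneg _)⟩
    have := Finset.card_filter_le (Finset.Ioc (k i) (k i + L i)) fun n => n ∈ A ∧ n + g ∈ A
    simp only [Nat.card_Ioc, add_tsub_cancel_left] at this
    exact_mod_cast this
  -- Sequential compactness of `[0, 1]^ℕ` gives one subsequence of windows that serves all `g` at
  -- once.
  obtain ⟨d, -, φ, hφ, hlim⟩ :=
    (isCompact_univ_pi fun _ : ℕ => isCompact_Icc (a := (0 : ℝ)) (b := 1)).tendsto_subseq hρ
  rw [tendsto_pi_nhds] at hlim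
  refine ⟨δ, k ∘ φ, L ∘ φ, d, hδ, ge_of_tendsto' (hlim 0) fun i => ?_, fun i => hL0 _,
    Filter.tendsto_atTop_mono (fun i => hL (φ i)) hφ.tendsto_atTop, hlim⟩
  have h1 := hd (φ i)
  simp only [Function.comp_apply, ρ]
  rw [le_div_iff₀ (by exact_mod_cast hL0 _)]
  refine h1.trans (le_of_eq ?_)
  rw [← Set.ncard_coe_finset]
  congr 2
  ext n
  simp [and_comm]

-- With `f(n) = #{a ∈ K | n + a ∈ A}`, average `2 f ≤ 1 + f ^ 2` over the windows. The mean of `f`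
-- tends to `|K| d 0`. The mean of `f ^ 2` tends to `∑ d |a - b|`, whose diagonal is `|K| d 0` and
-- whose other terms are below `η`.
open Finset Filter in
theorem exists_large_return {A : Set ℕ} [DecidablePred (· ∈ A)] {k L : ℕ → ℕ} {d : ℕ → ℝ}
    (hL0 : ∀ i, 0 < L i) (hL : Tendsto L atTop atTop)
    (hd : ∀ g, Tendsto (fun i => (#{n ∈ Ioc (k i) (k i + L i) | n ∈ A ∧ n + g ∈ A} : ℝ) / L i)
      atTop (nhds (d g)))
    (K : Finset ℕ) {η : ℝ} (hK : ∀ a ∈ K, ∀ b ∈ K, a < b → d (b - a) < η) :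
    K.card * d 0 ≤ 1 + K.card ^ 2 * max η 0 := by
  have hLr : Tendsto (fun i => (L i : ℝ)) atTop atTop := tendsto_natCast_atTop_atTop.comp hL
  have hshift : ∀ a g : ℕ, Tendsto (fun i =>
      (#{n ∈ Ioc (k i) (k i + L i) | n + a ∈ A ∧ n + a + g ∈ A} : ℝ) / L i) atTop
      (nhds (d g)) := fun a g => by
    have h0 : Tendsto (fun i => (a : ℝ) / L i) atTop (nhds 0) := hLr.const_div_atTop _
    have h1 := (hd g).sub h0
    have h2 := (hd g).add h0
    rw [sub_zero] at h1
    rw [add_zero] at h2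
    refine tendsto_of_tendsto_of_tendsto_of_le_of_le h1 h2 (fun i => ?_) fun i => ?_
    · have := card_filter_le_shift (fun n => n ∈ A ∧ n + g ∈ A) (k i) (L i) a
      simp only [← sub_div]
      gcongr
      rw [sub_le_iff_le_add]
      exact_mod_cast this
    · have := card_filter_shift_le (fun n => n ∈ A ∧ n + g ∈ A) (k i) (L i) a
      simp only [← add_div]
      gcongr
      exact_mod_cast this
  have hpair : ∀ a b : ℕ, Tendsto (fun i =>
      (#{n ∈ Ioc (k i) (k i + L i) | n + a ∈ A ∧ n + b ∈ A} : ℝ) / L i) atTop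
      (nhds (d (max a b - min a b))) := fun a b => by
    rcases le_total a b with h | h
    · have := hshift a (b - a)
      simp only [add_assoc, Nat.add_sub_cancel' h] at this
      simpa [h] using this
    · have := hshift b (a - b)
      simp only [add_assoc, Nat.add_sub_cancel' h] at this
      simpa [h, and_comm] using this
  have hlim1 := (tendsto_finsetSum K fun a _ => hpair a a).const_mul 2
  have hlim2 := tendsto_finsetSum K fun a _ => tendsto_finsetSum K fun b _ => hpair a b
  have hmain : 2 * ∑ a ∈ K, d (max a a - min a a) ≤
      1 + ∑ a ∈ K, ∑ b ∈ K, d (max a b - min a b) := by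
    refine le_of_tendsto_of_tendsto' hlim1 (hlim2.const_add 1) fun i => ?_
    have hLi : (0 : ℝ) < L i := by exact_mod_cast hL0 i
    simp only [← sum_div]
    rw [← mul_div_assoc, div_le_iff₀ hLi, add_mul, div_mul_cancel₀ _ hLi.ne', one_mul]
    have hLc : (L i : ℝ) = ∑ n ∈ Ioc (k i) (k i + L i), (1 : ℝ) := by simp
    simp only [card_filter, Nat.cast_sum]
    rw [hLc, sum_comm, mul_sum]
    have : ∑ a ∈ K, ∑ b ∈ K, ∑ n ∈ Ioc (k i) (k i + L i),
          ((if n + a ∈ A ∧ n + b ∈ A then 1 else 0 : ℕ) : ℝ) =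
        ∑ n ∈ Ioc (k i) (k i + L i), (∑ a ∈ K, if n + a ∈ A then (1 : ℝ) else 0) ^ 2 := by
      simp only [sq, sum_mul_sum]
      symm
      rw [sum_comm]
      refine sum_congr rfl fun a _ => ?_
      rw [sum_comm]
      refine sum_congr rfl fun b _ => sum_congr rfl fun n _ => ?_
      by_cases h1 : n + a ∈ A <;> by_cases h2 : n + b ∈ A <;> simp [h1, h2]
    rw [this, ← sum_add_distrib]
    refine sum_le_sum fun n _ => ?_
    simp only [and_self, Nat.cast_ite, Nat.cast_one, Nat.cast_zero]
    nlinarith [sq_nonneg ((∑ a ∈ K, if n + a ∈ A then (1 : ℝ) else 0) - 1)]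
  have hbound : ∑ a ∈ K, ∑ b ∈ K, d (max a b - min a b) ≤
      K.card * d 0 + K.card ^ 2 * max η 0 := by
    calc ∑ a ∈ K, ∑ b ∈ K, d (max a b - min a b)
        ≤ ∑ a ∈ K, ∑ b ∈ K, ((if b = a then d 0 else 0) + max η 0) := by
          refine sum_le_sum fun a ha => sum_le_sum fun b hb => ?_
          rcases lt_trichotomy a b with h | rfl | h
          · rw [if_neg h.ne', max_eq_right h.le, min_eq_left h.le, zero_add]
            exact (hK a ha b hb h).le.trans (le_max_left _ _)
          · simp
          · rw [if_neg h.ne, max_eq_left h.le, min_eq_right h.le, zero_add]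
            exact (hK b hb a ha h).le.trans (le_max_left _ _)
      _ = K.card * d 0 + K.card ^ 2 * max η 0 := by
          simp only [sum_add_distrib, sum_const, nsmul_eq_mul, sum_ite_eq']
          rw [sum_congr rfl fun a ha => if_pos ha]
          simp only [sum_const, nsmul_eq_mul]
          ring
  simp only [max_self, min_self, tsub_self, sum_const, nsmul_eq_mul] at hmain
  linarith

-- Otherwise there are arbitrarily long intervals on which `d < 1 / q ^ 2`. Adding one point at a
-- time from such intervals gives a set `K` of `q` elements all of whose differences have small `d`;
-- then `exists_large_return` yields `q * d 0 ≤ 2`, against the choice of `q`.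
open Finset Filter in
theorem exists_syndetic_return {A : Set ℕ} [DecidablePred (· ∈ A)] {k L : ℕ → ℕ} {d : ℕ → ℝ}
    (hL0 : ∀ i, 0 < L i) (hL : Tendsto L atTop atTop)
    (hd : ∀ g, Tendsto (fun i => (#{n ∈ Ioc (k i) (k i + L i) | n ∈ A ∧ n + g ∈ A} : ℝ) / L i)
      atTop (nhds (d g))) (hd0 : 0 < d 0) :
    ∃ η : ℝ, 0 < η ∧ ∃ R : ℕ, ∀ g, ∃ r ≤ R, η ≤ d (g + r) := by
  obtain ⟨q, hq⟩ := exists_nat_gt (2 / d 0)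
  rw [div_lt_iff₀ hd0] at hq
  have hq0 : (0 : ℝ) < q := by
    by_contra! h
    nlinarith
  refine ⟨1 / (q : ℝ) ^ 2, by positivity, ?_⟩
  by_contra! hR
  have hK : ∀ c : ℕ, ∃ K : Finset ℕ, K.card = c ∧
      ∀ a ∈ K, ∀ b ∈ K, a < b → d (b - a) < 1 / (q : ℝ) ^ 2 := by
    intro c
    induction c with
    | zero => exact ⟨∅, rfl, by simp⟩
    | succ c ih =>
      obtain ⟨K, hc, hK⟩ := ih
      obtain ⟨g, hg⟩ := hR (K.sup id + 1)
      have hle : ∀ a ∈ K, a ≤ K.sup id := fun a ha => le_sup (f := id) ha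
      refine ⟨insert (g + (K.sup id + 1)) K, ?_, fun a ha b hb hab => ?_⟩
      · rw [card_insert_of_notMem, hc]
        intro h
        have := hle _ h
        omega
      · rw [mem_insert] at ha hb
        rcases hb with rfl | hb
        · rcases ha with rfl | ha
          · exact absurd hab (lt_irrefl _)
          · rw [Nat.add_sub_assoc (by have := hle a ha; omega)]
            exact hg _ (Nat.sub_le _ _)
        · rcases ha with rfl | ha
          · have := hle b hb
            omega
          · exact hK a ha b hb hab
  obtain ⟨K, hc, hK⟩ := hK q
  have := exists_large_return hL0 hL hd K hK
  rw [hc, max_eq_left (by positivity), mul_one_div_cancel (by positivity)] at this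
  linarith

open Finset Filter in
/-- If `A` has positive upper Banach density, the sums of `c` over the positive return times
`(A - n) ∩ (0, ∞)`, `n ∈ A`, are bounded, and `c` does not grow too fast backwards, then `c` is
summable. -/
theorem summable_of_sum_return_le {A : Set ℕ} (hA : A ∈ posUpperBanachDensity) {c : ℕ → ℝ}
    (hc : ∀ g, 0 ≤ c g) {C : ℝ} (hC : ∀ g, c g ≤ C * c (g + 1)) {K : ℝ}
    (hK : ∀ n ∈ A, ∀ F : Finset ℕ, (∀ g ∈ F, 0 < g ∧ n + g ∈ A) → ∑ g ∈ F, c g ≤ K) :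
    Summable c := by
  classical
  obtain ⟨δ, k, L, d, hδ, hd0, hL0, hL, hd⟩ := exists_windows hA
  obtain ⟨η, hη, R, hR⟩ := exists_syndetic_return hL0 hL hd (hδ.trans_le hd0)
  have hdn : ∀ g, 0 ≤ d g := fun g => ge_of_tendsto' (hd g) fun i => by positivity
  have hAne : A.Nonempty := by
    obtain ⟨δ, hδ, h⟩ := mem_posUpperBanachDensity_iff.1 hA
    obtain ⟨k, L, -, -, hL, h⟩ := h 0
    by_contra! hA0
    rw [hA0, Set.empty_inter, Set.ncard_empty, Nat.cast_zero] at h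
    have : (0 : ℝ) < L := by exact_mod_cast hL
    nlinarith
  have hK0 : 0 ≤ K := by
    obtain ⟨n, hn⟩ := hAne
    simpa using hK n hn ∅ (by simp)
  -- Average the hypothesis over the `n` of a window and exchange the two sums.
  have hsum : ∀ F : Finset ℕ, (∀ g ∈ F, 0 < g) → ∑ g ∈ F, c g * d g ≤ K := fun F hF => by
    refine le_of_tendsto' (tendsto_finsetSum F fun g _ => (hd g).const_mul (c g)) fun i => ?_
    have hLi : (0 : ℝ) < L i := by exact_mod_cast hL0 i
    simp only [← mul_div_assoc, ← sum_div]
    rw [div_le_iff₀ hLi]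
    simp only [card_filter, Nat.cast_sum, mul_sum]
    rw [sum_comm]
    calc _ ≤ ∑ n ∈ Ioc (k i) (k i + L i), K := by
          refine sum_le_sum fun n _ => ?_
          by_cases hn : n ∈ A
          · refine le_trans (le_of_eq ?_) (hK n hn {g ∈ F | n + g ∈ A} fun g hg => ?_)
            · rw [sum_filter]
              refine sum_congr rfl fun g _ => ?_
              by_cases h : n + g ∈ A <;> simp [hn, h]
            · rw [mem_filter] at hg
              exact ⟨hF g hg.1, hg.2⟩
          · simpa [hn] using hK0
      _ = K * L i := by simp [mul_comm]
  -- Keep only the `g` that are frequent return times; there `c g ≤ c g * d g / η`.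
  set c' : ℕ → ℝ := fun g => if 0 < g ∧ η ≤ d g then c g else 0
  have hc'n : ∀ g, 0 ≤ c' g := fun g => by
    simp only [c']
    split_ifs
    exacts [hc g, le_rfl]
  have hc' : Summable c' := by
    refine summable_of_sum_le (c := K / η) hc'n fun F => ?_
    rw [le_div_iff₀ hη, sum_mul]
    refine le_trans ?_ (hsum {g ∈ F | 0 < g} fun g hg => (mem_filter.1 hg).2)
    rw [sum_filter]
    refine sum_le_sum fun g _ => ?_
    simp only [c']
    split_ifs with h1 h2 h2
    · exact mul_le_mul_of_nonneg_left h1.2 (hc g)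
    · exact absurd h1.1 h2
    · rw [zero_mul]
      exact mul_nonneg (hc g) (hdn g)
    · rw [zero_mul]
  have hpow : ∀ r g, c g ≤ max C 1 ^ r * c (g + r) := fun r => by
    induction r with
    | zero => simp
    | succ r ih =>
      intro g
      calc c g ≤ max C 1 ^ r * c (g + r) := ih g
        _ ≤ max C 1 ^ r * (max C 1 * c (g + r + 1)) := by
          gcongr
          exact (hC _).trans (mul_le_mul_of_nonneg_right (le_max_left _ _) (hc _))
        _ = _ := by rw [pow_succ]; ring_nf
  -- Each `g + 1` lies within `R` of a frequent return time, so `c (g + 1)` is dominated by a sum of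
  -- `R + 1` shifts of `c'`.
  rw [← summable_nat_add_iff 1]
  refine Summable.of_nonneg_of_le (fun g => hc _) (fun g => ?_)
    ((summable_sum (s := range (R + 1)) fun r _ =>
      (summable_nat_add_iff (r + 1)).2 hc').mul_left (max C 1 ^ R))
  obtain ⟨r, hr, hηr⟩ := hR (g + 1)
  calc c (g + 1) ≤ max C 1 ^ r * c (g + 1 + r) := hpow r _
    _ ≤ max C 1 ^ R * c (g + 1 + r) :=
      mul_le_mul_of_nonneg_right (pow_le_pow_right₀ (le_max_right _ _) hr) (hc _)
    _ = max C 1 ^ R * c' (g + (r + 1)) := by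
      rw [add_right_comm, add_assoc] at hηr ⊢
      simp only [c']
      rw [if_pos ⟨by omega, hηr⟩]
    _ ≤ _ := by
      gcongr
      exact single_le_sum (f := fun r => c' (g + (r + 1))) (fun r _ => hc'n _)
        (mem_range.2 (Nat.lt_succ_of_le hr))

/-! ### Hypercyclicity: general facts -/

section General

variable {𝕜 X : Type*} [NontriviallyNormedField 𝕜] [NormedAddCommGroup X] [NormedSpace 𝕜 X]

theorem piMap_pow_apply {N : ℕ} (T : Fin N → X →L[𝕜] X) (n : ℕ) (x : Fin N → X) :
    (ContinuousLinearMap.piMap T ^ n) x = fun s => (T s ^ n) (x s) := by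
  induction n with
  | zero => rfl
  | succ n ih =>
    rw [pow_succ', mul_apply_eq_comp, ih]
    funext s
    rw [pow_succ', mul_apply_eq_comp]
    rfl

/-- Superposition of finite blocks: if along finite pieces of the `A r` the orbits can be steered
close to the targets `y r` by small vectors with eventually vanishing orbits, then some diagonal
orbit visits every target along a set of the family. -/
theorem exists_common_orbit [CompleteSpace X] {𝒜 : Set (Set ℕ)}
    (h𝒜 : 𝒜 = posUpperBanachDensity ∨ 𝒜 = posUpperDensity) {N : ℕ} (T : Fin N → X →L[𝕜] X)
    (E : Set X) (hE : ∀ x ∈ E, ∃ M, ∀ n, M ≤ n → ∀ s, (T s ^ n) x = 0)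
    (y : ℕ → Fin N → X) (η : ℕ → ℝ) (hη : ∀ r, 0 < η r) (hanti : Antitone η)
    (h : ∀ r, ∃ A ∈ 𝒜, ∀ ε > 0, ∃ M, ∀ F : Finset ℕ, ↑F ⊆ A → (∀ n ∈ F, M < n) →
      ∃ x ∈ E, ‖x‖ ≤ ε ∧ ∀ n ∈ F, ∀ s, ‖(T s ^ n) x - y r s‖ ≤ η r) :
    ∃ x : X, ∀ r, {n | ∀ s, ‖(T s ^ n) x - y r s‖ ≤ 2 * η r} ∈ 𝒜 := by
  obtain ⟨Blk, hBlk, hBlk'⟩ := exists_block_criterion h𝒜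
  choose A hA hAx using h
  choose δ hδ hBlkA using fun r => hBlk (A r) (hA r)
  -- Block `i` treats target `ρ i`; every target recurs infinitely often.
  set ρ : ℕ → ℕ := fun i => i.unpair.1
  set C : ℝ := 1 + ∑ s, ‖T s‖
  have hC1 : 1 ≤ C := le_add_of_nonneg_right (Finset.sum_nonneg fun s _ => norm_nonneg _)
  have hTC : ∀ s, ‖T s‖ ≤ C := fun s =>
    (Finset.single_le_sum (f := fun s => ‖T s‖) (fun s _ => norm_nonneg _)
      (Finset.mem_univ s)).trans (le_add_of_nonneg_left zero_le_one)
  -- Block `i` acts at times in `(P, Q]`. The factor `C ^ P` keeps its orbit small up to time `P`,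
  -- and from time `Q` on its orbit is zero.
  have hstep : ∀ i P : ℕ, ∃ (F : Finset ℕ) (x : X) (Q : ℕ), P < Q ∧ ↑F ⊆ A (ρ i) ∧
      (∀ n ∈ F, P < n ∧ n ≤ Q) ∧ (∃ M, P ≤ M ∧ Blk (δ (ρ i)) M F) ∧
      ‖x‖ ≤ (1 / 2) ^ (i + 1) * η i / C ^ P ∧
      (∀ n ∈ F, ∀ s, ‖(T s ^ n) x - y (ρ i) s‖ ≤ η (ρ i)) ∧
      ∀ n, Q ≤ n → ∀ s, (T s ^ n) x = 0 := by
    intro i P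
    obtain ⟨M, hM⟩ := hAx (ρ i) ((1 / 2) ^ (i + 1) * η i / C ^ P)
      (by have := hη i; positivity)
    obtain ⟨F, hFA, hF, hFB⟩ := hBlkA (ρ i) (max P M)
    obtain ⟨x, hxE, hx, hxF⟩ := hM F hFA fun n hn => (le_max_right _ _).trans_lt (hF n hn)
    obtain ⟨M', hM'⟩ := hE x hxE
    refine ⟨F, x, max (max (P + 1) M') (F.sup id), ?_, hFA, fun n hn => ⟨?_, ?_⟩,
      ⟨_, le_max_left _ _, hFB⟩, hx, hxF, fun n hn => hM' n ?_⟩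
    · exact lt_of_lt_of_le (Nat.lt_succ_self P) ((le_max_left _ _).trans (le_max_left _ _))
    · exact (le_max_left _ _).trans_lt (hF n hn)
    · exact (Finset.le_sup (f := id) hn).trans (le_max_right _ _)
    · exact ((le_max_right _ _).trans (le_max_left _ _)).trans hn
  choose F x Q hPQ hFA hF hFB hx hxF hxQ using hstep
  set P : ℕ → ℕ := fun i => Nat.rec 0 (fun i P => Q i P) i
  have hPsucc : ∀ i, P (i + 1) = Q i (P i) := fun i => rfl
  have hPmono : StrictMono P := strictMono_nat_of_lt_succ fun i => hPQ i (P i)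
  have hTn : ∀ s n, ‖T s ^ n‖ ≤ C ^ n := fun s n => by
    refine (ContinuousLinearMap.opNorm_le_bound _ (by positivity) fun v => ?_)
    induction n with
    | zero => simp
    | succ n ih =>
      rw [pow_succ', mul_apply_eq_comp, pow_succ', mul_assoc]
      refine ((T s).le_opNorm _).trans ?_
      gcongr
      exact hTC s
  have hTx : ∀ s n i, n ≤ P i →
      ‖(T s ^ n) (x i (P i))‖ ≤ (1 / 2) ^ (i + 1) * η i := fun s n i hn => by
    have hCn : C ^ n ≤ C ^ P i := pow_le_pow_right₀ hC1 hn
    calc ‖(T s ^ n) (x i (P i))‖ ≤ C ^ P i * ((1 / 2) ^ (i + 1) * η i / C ^ P i) :=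
          ((T s ^ n).le_opNorm _).trans (mul_le_mul ((hTn s n).trans hCn) (hx i _)
            (norm_nonneg _) (by positivity))
      _ = _ := mul_div_cancel₀ _ (by positivity)
  have hgeom : Summable fun i : ℕ => (1 / 2 : ℝ) ^ (i + 1) :=
    (summable_nat_add_iff 1).2 summable_geometric_two
  have hxs : Summable fun i => x i (P i) := by
    refine Summable.of_norm_bounded (hgeom.mul_right (η 0)) fun i => ?_
    refine (hx i (P i)).trans ((div_le_self (by have := hη i; positivity)
      (one_le_pow₀ hC1)).trans ?_)
    gcongr
    exact hanti (Nat.zero_le i)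
  refine ⟨∑' i, x i (P i), fun r => hBlk' _ (δ r) (hδ r) fun M₀ => ?_⟩
  -- Since `i ≥ M₀` the block lies beyond `M₀`; since `i ≥ r` the later blocks have errors bounded
  -- by `η r`.
  set i := Nat.pair r M₀
  have hρ : ρ i = r := by simp [ρ, i]
  obtain ⟨M, hM, hMB⟩ := hFB i (P i)
  rw [hρ] at hMB
  refine ⟨M, ((Nat.right_le_pair r M₀).trans hPmono.le_apply).trans hM, F i (P i),
    fun n hn s => ?_, hMB⟩
  have hmap : (T s ^ n) (∑' i, x i (P i)) = ∑' i, (T s ^ n) (x i (P i)) :=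
    (T s ^ n).map_tsum hxs
  have hTs : Summable fun i => (T s ^ n) (x i (P i)) := hxs.mapL (T s ^ n)
  obtain ⟨hn1, hn2⟩ := hF i (P i) n hn
  have hmain : ‖(T s ^ n) (x i (P i)) - y r s‖ ≤ η r := by
    have := hxF i (P i) n hn s
    rwa [hρ] at this
  -- Earlier blocks have already vanished at time `n`, and later ones form a geometric series.
  have hrest : ‖∑' j, (if j = i then 0 else (T s ^ n) (x j (P j)))‖ ≤ η r := by
    refine tsum_of_norm_bounded (a := η r) (g := fun j => (1 / 2 : ℝ) ^ (j + 1) * η r) ?_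
      fun j => ?_
    · have h1 : HasSum (fun j : ℕ => (1 / 2 : ℝ) ^ j * ((1 / 2) * η r)) (2 * ((1 / 2) * η r)) :=
        hasSum_geometric_two.mul_right _
      convert h1 using 1
      · funext j
        ring
      · ring
    · have h0 : 0 ≤ (1 / 2 : ℝ) ^ (j + 1) * η r := by have := hη r; positivity
      rcases lt_trichotomy j i with hj | rfl | hj
      · rw [if_neg hj.ne, hxQ j (P j) n, norm_zero]
        · exact h0
        · exact ((hPsucc j).symm.le.trans (hPmono.monotone hj)).trans hn1.le
      · simpa using h0
      · rw [if_neg hj.ne']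
        refine (hTx s n j (hn2.trans ((hPsucc i).symm.le.trans (hPmono.monotone hj)))).trans ?_
        gcongr
        exact hanti ((Nat.left_le_pair r M₀).trans hj.le)
  rw [hmap, hTs.tsum_eq_add_tsum_ite i, add_sub_right_comm]
  exact (norm_add_le _ _).trans (by linarith)

end General

/-! ### Iterates of pseudo-shifts -/

namespace PseudoShift

variable {𝕜 : Type*} [RCLike 𝕜] (S : PseudoShift 𝕜)

theorem lt_f (j : ℕ+) : j < S.f j := by
  induction j using PNat.recOn with
  | one => exact S.one_lt
  | succ j ih => exact (PNat.add_one_le_iff.2 ih).trans_lt (S.strictMono (PNat.lt_add_right j 1))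

theorem iterate_injective (n : ℕ) : Function.Injective (S.f^[n]) :=
  S.strictMono.injective.iterate n

theorem iterate_strictMono (j : ℕ+) : StrictMono fun n => S.f^[n] j :=
  strictMono_nat_of_lt_succ fun n => by
    rw [Function.iterate_succ_apply']
    exact S.lt_f _

theorem lt_iterate (n : ℕ) (j : ℕ+) : n < (S.f^[n] j : ℕ) := by
  induction n with
  | zero => exact j.pos
  | succ n ih =>
    rw [Function.iterate_succ_apply']
    have : (S.f^[n] j : ℕ) < S.f (S.f^[n] j) := S.lt_f _
    omega

theorem W_zero (j : ℕ+) : S.W j 0 = 1 := by simp [W]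

theorem W_succ (j : ℕ+) (n : ℕ) : S.W j (n + 1) = S.W j n * S.w (S.f^[n + 1] j) := by
  rw [W, W, Finset.prod_Icc_succ_top (by omega)]

theorem W_add (j : ℕ+) (m n : ℕ) : S.W j (m + n) = S.W j m * S.W (S.f^[m] j) n := by
  induction n with
  | zero => simp [W_zero]
  | succ n ih =>
    rw [← add_assoc, W_succ, ih, W_succ, mul_assoc, ← Function.iterate_add_apply]
    congr 4
    omega

theorem op_pow_apply (p : ℝ≥0∞) [Fact (1 ≤ p)] (hp : p ≠ ∞) (n : ℕ)
    (x : lp (fun _ : ℕ+ => 𝕜) p) (j : ℕ+) :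
    (S.op p hp ^ n) x j = S.W j n * x (S.f^[n] j) := by
  induction n generalizing x with
  | zero => simp [W_zero]
  | succ n ih =>
    rw [pow_succ, mul_apply_eq_comp, ih, op_apply, W_succ, mul_assoc,
      Function.iterate_succ_apply']

theorem fInv_mem_Ioi {l k : ℕ+} {n : ℕ} (hk : k ∈ S.f^[n] '' Set.Ioi l) :
    l < S.fInv n k ∧ S.f^[n] (S.fInv n k) = k := by
  obtain ⟨i, hi, rfl⟩ := hk
  rw [fInv_iterate]
  exact ⟨hi, rfl⟩

theorem fInv_mem_Iic {l k : ℕ+} {n : ℕ} (hk : k ∈ S.f^[n] '' Set.Iic l) :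
    S.fInv n k ≤ l ∧ S.f^[n] (S.fInv n k) = k := by
  obtain ⟨i, hi, rfl⟩ := hk
  rw [fInv_iterate]
  exact ⟨hi, rfl⟩

end PseudoShift

/-! ### Finitely supported vectors in `ℓ^p` -/

section Lp

variable {𝕜 : Type*} [RCLike 𝕜] (p : ℝ≥0∞)

/-- The vector of `ℓ^p` that agrees with `g` on the finite set `K` and vanishes elsewhere. -/
noncomputable def finVec (K : Finset ℕ+) (g : ℕ+ → 𝕜) : lp (fun _ : ℕ+ => 𝕜) p :=
  ∑ k ∈ K, lp.single p k (g k)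

theorem finVec_apply (K : Finset ℕ+) (g : ℕ+ → 𝕜) (i : ℕ+) :
    finVec p K g i = if i ∈ K then g i else 0 := by
  rw [finVec, lp.coeFn_sum, Finset.sum_apply]
  simp [lp.single_apply, Pi.single_apply]

end Lp

/-! ### Sums in `[0, ∞]` as bounds on finite real sums -/

section Enorm

variable {𝕜 : Type*} [RCLike 𝕜]

/-- Nonvanishing of `v` reconciles division by zero in `[0, ∞]` with the real convention `x / 0 =
0`. -/
theorem tsum_enorm_div_le_iff {q : ℝ} (hq : 0 ≤ q) (P : ℕ → Prop) (u v : ℕ → 𝕜)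
    (hv : ∀ m, v m ≠ 0) {ε : ℝ} (hε : 0 ≤ ε) :
    ∑' m : {m // P m}, ‖u m‖ₑ ^ q / ‖v m‖ₑ ^ q ≤ ENNReal.ofReal ε ↔
      ∀ G : Finset ℕ, (∀ m ∈ G, P m) → ∑ m ∈ G, ‖u m‖ ^ q / ‖v m‖ ^ q ≤ ε := by
  have hterm : ∀ m, ‖u m‖ₑ ^ q / ‖v m‖ₑ ^ q = ENNReal.ofReal (‖u m‖ ^ q / ‖v m‖ ^ q) := fun m => by
    have : 0 < ‖v m‖ := norm_pos_iff.2 (hv m)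
    rw [ENNReal.ofReal_div_of_pos (by positivity),
      ← ENNReal.ofReal_rpow_of_nonneg (norm_nonneg _) hq,
      ← ENNReal.ofReal_rpow_of_nonneg (norm_nonneg _) hq, ofReal_norm, ofReal_norm]
  classical
  simp only [hterm]
  rw [ENNReal.tsum_eq_iSup_sum, iSup_le_iff]
  have hnn : ∀ m, 0 ≤ ‖u m‖ ^ q / ‖v m‖ ^ q := fun m => by positivity
  constructor
  · intro h G hG
    have h1 := h (G.subtype P)
    rw [Finset.sum_subtype_of_mem (fun m => ENNReal.ofReal (‖u m‖ ^ q / ‖v m‖ ^ q)) hG,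
      ← ENNReal.ofReal_sum_of_nonneg fun m _ => hnn m] at h1
    exact (ENNReal.ofReal_le_ofReal_iff hε).1 h1
  · intro h G
    rw [← ENNReal.ofReal_sum_of_nonneg fun (m : {m // P m}) _ => hnn m]
    refine ENNReal.ofReal_le_ofReal ?_
    have h1 := h (G.map (Function.Embedding.subtype P)) fun m hm => by
      obtain ⟨m', -, rfl⟩ := Finset.mem_map.1 hm
      exact m'.2
    rwa [Finset.sum_map] at h1

theorem tsum_one_div_enorm_lt_top_iff {q : ℝ} (hq : 0 < q) (v : ℕ → 𝕜) (hv0 : v 0 ≠ 0) :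
    ∑' n : ℕ+, 1 / ‖v n‖ₑ ^ q < ∞ ↔
      (∀ n, v n ≠ 0) ∧ Summable fun n => 1 / ‖v n‖ ^ q := by
  have hnn : ∀ n, 0 ≤ 1 / ‖v n‖ ^ q := fun n => by positivity
  have hkey : ∀ (_ : ∀ n, v n ≠ 0) {ε : ℝ} (_ : 0 ≤ ε),
      ∑' n : ℕ+, 1 / ‖v n‖ₑ ^ q ≤ ENNReal.ofReal ε ↔
        ∀ G : Finset ℕ, (∀ m ∈ G, 0 < m) → ∑ m ∈ G, 1 / ‖v m‖ ^ q ≤ ε := fun hv ε hε => by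
    have := tsum_enorm_div_le_iff hq.le (fun m => 0 < m) (fun _ => (1 : 𝕜)) v hv hε
    simp only [enorm_one, ENNReal.one_rpow, norm_one, Real.one_rpow] at this
    exact this
  constructor
  · intro h
    have hv : ∀ n, v n ≠ 0 := fun n hn => by
      rcases Nat.eq_zero_or_pos n with rfl | hn0
      · exact hv0 hn
      · have := ENNReal.le_tsum (f := fun n : ℕ+ => 1 / ‖v n‖ₑ ^ q) ⟨n, hn0⟩
        simp only [PNat.mk_coe, hn, enorm_zero, ENNReal.zero_rpow_of_pos hq] at this
        rw [ENNReal.div_zero one_ne_zero, top_le_iff] at this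
        exact h.ne this
    refine ⟨hv, ?_⟩
    have h1 := (hkey hv ENNReal.toReal_nonneg).1 (ENNReal.ofReal_toReal h.ne).ge
    rw [← summable_nat_add_iff 1]
    refine summable_of_sum_le (c := (∑' n : ℕ+, 1 / ‖v n‖ₑ ^ q).toReal) (fun n => hnn _) fun F => ?_
    have := h1 (F.map ⟨(· + 1), add_left_injective 1⟩) fun m hm => by
      obtain ⟨m', -, rfl⟩ := Finset.mem_map.1 hm
      exact Nat.succ_pos m'
    rwa [Finset.sum_map] at this
  · rintro ⟨hv, hs⟩
    exact ((hkey hv (tsum_nonneg hnn)).2 fun G _ => hs.sum_le_tsum G fun n _ => hnn n).trans_lt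
      ENNReal.ofReal_lt_top

end Enorm

/-! ### Necessity -/

section Necessity

variable {𝕜 : Type*} [RCLike 𝕜] {p : ℝ≥0∞} [Fact (1 ≤ p)] {hp : p ≠ ∞} {N : ℕ}
  {S : Fin N → PseudoShift 𝕜} {𝒜 : Set (Set ℕ)} {x : lp (fun _ : ℕ+ => 𝕜) p}

theorem visits_mem
    (hx : IsHypercyclicVector 𝒜 (ContinuousLinearMap.piMap fun s => (S s).op p hp) fun _ => x)
    (y : Fin N → lp (fun _ : ℕ+ => 𝕜) p) {δ : ℝ} (hδ : 0 < δ) :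
    {n | ∀ s, ‖((S s).op p hp ^ n) x - y s‖ < δ} ∈ 𝒜 := by
  have h := hx (Metric.ball y δ) Metric.isOpen_ball ⟨y, Metric.mem_ball_self hδ⟩
  simp only [piMap_pow_apply, Metric.mem_ball, dist_pi_lt_iff hδ] at h
  simp only [dist_eq_norm] at h
  exact h

theorem exists_gt_of_mem_posUpperBanachDensity {A : Set ℕ} (hA : A ∈ posUpperBanachDensity)
    (M : ℕ) : ∃ n ∈ A, M < n := by
  obtain ⟨δ, hδ, h⟩ := mem_posUpperBanachDensity_iff.1 hA
  obtain ⟨k, L, hk, -, hL, hδL⟩ := h M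
  have : 0 < (A ∩ Set.Ioc k (k + L)).ncard := by
    have hL' : (0 : ℝ) < L := by exact_mod_cast hL
    exact_mod_cast (mul_pos hδ hL').trans_le hδL
  obtain ⟨n, hn, hkn, -⟩ := Set.nonempty_of_ncard_ne_zero this.ne'
  exact ⟨n, hn, hk.trans_lt hkn⟩

/-- If `n` and `n + g` lie in `A` with `g > 0`, coordinate `f^g(j)` of `T^n x - e_j` is `W_{j,n+g}
x_{f^{n+g}(j)} / W_{j,g}`, of modulus at least `1 / (2 |W_{j,g}|)`. As `‖T^n x - e_j‖ < 1/2`, the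
sums over return times are at most 1. -/
theorem summable_of_visits (S : PseudoShift 𝕜) {A : Set ℕ} (hA : A ∈ posUpperBanachDensity)
    (j : ℕ+) (hx : ∀ n ∈ A, ‖(S.op p hp ^ n) x - lp.single p j 1‖ < 1 / 2) :
    (∀ n, S.W j n ≠ 0) ∧ Summable fun n => 1 / ‖S.W j n‖ ^ p.toReal := by
  have hp1 : 1 ≤ p.toReal := (ENNReal.dichotomy p).resolve_left hp
  have hp0 : 0 < p.toReal := one_pos.trans_le hp1
  have hp0' : p ≠ 0 := (one_pos.trans_le (Fact.out : 1 ≤ p)).ne'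
  have hlow : ∀ n ∈ A, 1 / 2 ≤ ‖S.W j n * x (S.f^[n] j)‖ := fun n hn => by
    have h1 := (lp.norm_apply_le_norm hp0' ((S.op p hp ^ n) x - lp.single p j 1) j).trans_lt
      (hx n hn)
    rw [lp.coeFn_sub, Pi.sub_apply, S.op_pow_apply, lp.single_apply_self] at h1
    have h2 := norm_sub_norm_le (1 : 𝕜) (S.W j n * x (S.f^[n] j))
    rw [norm_one, norm_sub_rev] at h2
    linarith
  -- A zero of `W j` would persist at all later times, in particular at some visit.
  have hW : ∀ n, S.W j n ≠ 0 := fun g hg => by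
    obtain ⟨n, hn, hgn⟩ := exists_gt_of_mem_posUpperBanachDensity hA g
    have h1 := hlow n hn
    obtain ⟨m, rfl⟩ := Nat.exists_eq_add_of_lt hgn
    rw [add_assoc, S.W_add, hg, zero_mul, zero_mul, norm_zero] at h1
    norm_num at h1
  refine ⟨hW, ?_⟩
  obtain ⟨C, hC⟩ := S.bounded
  have hC0 : 0 ≤ C := (norm_nonneg _).trans (hC 1)
  refine summable_of_sum_return_le hA (C := C ^ p.toReal) (K := 1) (fun g => by positivity)
    (fun g => ?_) fun n hn F hF => ?_
  · have h0 : 0 < ‖S.W j g‖ := norm_pos_iff.2 (hW g)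
    have h1 : 0 < ‖S.W j (g + 1)‖ := norm_pos_iff.2 (hW _)
    rw [mul_one_div, div_le_div_iff₀ (by positivity) (by positivity), one_mul,
      ← Real.mul_rpow hC0 h0.le]
    refine Real.rpow_le_rpow h1.le ?_ hp0.le
    rw [S.W_succ, norm_mul, mul_comm, Function.iterate_succ_apply']
    gcongr
    exact hC _
  · set u := (S.op p hp ^ n) x - lp.single p j 1
    have hterm : ∀ g ∈ F, (1 / 2 : ℝ) ^ p.toReal * (1 / ‖S.W j g‖ ^ p.toReal) ≤
        ‖u (S.f^[g] j)‖ ^ p.toReal := fun g hg => by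
      obtain ⟨hg0, hgA⟩ := hF g hg
      have h0 : 0 < ‖S.W j g‖ := norm_pos_iff.2 (hW g)
      have hne : S.f^[g] j ≠ j := ((S.iterate_strictMono j) hg0).ne'
      have hu : u (S.f^[g] j) = S.W (S.f^[g] j) n * x (S.f^[n + g] j) := by
        simp only [u]
        rw [lp.coeFn_sub, Pi.sub_apply, S.op_pow_apply, lp.single_apply_ne p j 1 hne, sub_zero,
          ← Function.iterate_add_apply]
      have h1 := hlow _ hgA
      rw [add_comm n g, S.W_add, mul_assoc, norm_mul, add_comm g n, ← hu] at h1
      rw [mul_one_div, div_le_iff₀ (by positivity), ← Real.mul_rpow (norm_nonneg _) h0.le]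
      refine Real.rpow_le_rpow (by norm_num) ?_ hp0.le
      rwa [mul_comm]
    have h2 : (1 / 2 : ℝ) ^ p.toReal * ∑ g ∈ F, 1 / ‖S.W j g‖ ^ p.toReal ≤
        (1 / 2 : ℝ) ^ p.toReal * 1 := by
      rw [Finset.mul_sum, mul_one]
      refine (Finset.sum_le_sum hterm).trans ?_
      rw [← Finset.sum_image (f := fun k => ‖u k‖ ^ p.toReal) (g := fun g => S.f^[g] j)
        (s := F) (S.iterate_strictMono j).injective.injOn]
      refine (lp.sum_rpow_le_norm_rpow hp0 u _).trans ?_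
      exact Real.rpow_le_rpow (norm_nonneg _) (hx n hn).le hp0.le
    exact le_of_mul_le_mul_left h2 (by positivity)

/-- The numerator `u b - v a` is at most `2 δ β`, and `|v b| ≥ α ^ 2 / 2`; hence the factor 4. -/
theorem norm_div_sub_div_le {u v a b : 𝕜} {δ α β ε : ℝ} (hα : 0 < α) (hu : ‖u - a‖ ≤ δ)
    (hv : ‖v - b‖ ≤ δ) (ha : ‖a‖ ≤ β) (hb : α ≤ ‖b‖) (hb' : ‖b‖ ≤ β) (hδα : δ ≤ α / 2)
    (hδ : 4 * δ * β ≤ ε * α ^ 2) : ‖u / v - a / b‖ ≤ ε := by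
  have hvn : α / 2 ≤ ‖v‖ := by
    have := norm_sub_norm_le b v
    rw [norm_sub_rev] at this
    linarith
  have hv0 : v ≠ 0 := norm_pos_iff.1 (by linarith)
  have hb0 : b ≠ 0 := norm_pos_iff.1 (by linarith)
  have hβ : 0 ≤ β := (norm_nonneg _).trans ha
  have hδ0 : 0 ≤ δ := (norm_nonneg _).trans hu
  have hε : 0 ≤ ε := by
    by_contra! h
    have h1 : 0 ≤ 4 * δ * β := by positivity
    nlinarith [sq_pos_of_pos hα]
  rw [div_sub_div _ _ hv0 hb0, norm_div, norm_mul, div_le_iff₀ (by positivity)]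
  have h1 : ‖u * b - v * a‖ ≤ δ * β + δ * β := by
    have : u * b - v * a = (u - a) * b - (v - b) * a := by ring
    rw [this]
    refine (norm_sub_le _ _).trans ?_
    rw [norm_mul, norm_mul]
    gcongr
  have h2 : ε * (α / 2 * α) ≤ ε * (‖v‖ * ‖b‖) := by gcongr
  nlinarith

theorem exists_norm_bounds (l : ℕ+) {a : Fin N → ℕ+ → 𝕜}
    (ha : ∀ s, ∀ j ∈ Set.Iic l, a s j ≠ 0) :
    ∃ α β : ℝ, 0 < α ∧ 0 < β ∧ ∀ s, ∀ j ≤ l, α ≤ ‖a s j‖ ∧ ‖a s j‖ ≤ β := by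
  obtain ⟨β, hβ⟩ := ((Finset.univ ×ˢ Finset.Icc 1 l).image
    fun q : Fin N × ℕ+ => ‖a q.1 q.2‖).bddAbove
  obtain ⟨γ, hγ⟩ := ((Finset.univ ×ˢ Finset.Icc 1 l).image
    fun q : Fin N × ℕ+ => ‖a q.1 q.2‖⁻¹).bddAbove
  have hmem : ∀ s, ∀ j ≤ l, (s, j) ∈ (Finset.univ : Finset (Fin N)) ×ˢ Finset.Icc 1 l :=
    fun s j hj => by simp [hj]
  refine ⟨(max γ 1)⁻¹, max β 1, by positivity, by positivity, fun s j hj => ⟨?_, ?_⟩⟩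
  · have h1 : 0 < ‖a s j‖ := norm_pos_iff.2 (ha s j hj)
    rw [inv_le_comm₀ (by positivity) h1]
    exact (hγ (Finset.mem_coe.2 (Finset.mem_image_of_mem _ (hmem s j hj)))).trans (le_max_left _ _)
  · exact (hβ (Finset.mem_coe.2 (Finset.mem_image_of_mem _ (hmem s j hj)))).trans (le_max_left _ _)

theorem conditions_of_disjointHypercyclic
    (h𝒜 : 𝒜 = posUpperBanachDensity ∨ 𝒜 = posUpperDensity)
    (hx : IsHypercyclicVector 𝒜 (ContinuousLinearMap.piMap fun s => (S s).op p hp) fun _ => x) :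
    (∀ (j : ℕ+) (s : Fin N), ∑' n : ℕ+, 1 / ‖(S s).W j n‖ₑ ^ p.toReal < ∞) ∧
      (∀ (l : ℕ+) (a : Fin N → ℕ+ → 𝕜), (∀ s, ∀ j ∈ Set.Iic l, a s j ≠ 0) →
        ∀ ε : ℝ, 0 < ε → ∃ A ∈ 𝒜, ∀ s t : Fin N, s ≠ t → ∀ n ∈ A,
          (∀ j ∈ Set.Iic l,
            ∑' m : {m : ℕ // m ∈ A ∧ (S t).f^[m] j ∈ (S s).f^[n] '' Set.Ioi l},
              ‖(S s).W ((S s).fInv n ((S t).f^[m] j)) n‖ₑ ^ p.toReal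
                / ‖(S t).W j m‖ₑ ^ p.toReal ≤ ENNReal.ofReal ε) ∧
          (∀ k ∈ ((S t).f^[n] '' Set.Iic l) ∩ ((S s).f^[n] '' Set.Iic l),
            ‖(S s).W ((S s).fInv n k) n / (S t).W ((S t).fInv n k) n
              - a s ((S s).fInv n k) / a t ((S t).fInv n k)‖ ≤ ε)) := by
  have hp1 : 1 ≤ p.toReal := (ENNReal.dichotomy p).resolve_left hp
  have hp0 : 0 < p.toReal := one_pos.trans_le hp1
  have hp0' : p ≠ 0 := (one_pos.trans_le (Fact.out : 1 ≤ p)).ne'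
  have hBd : 𝒜 ⊆ posUpperBanachDensity := by
    rcases h𝒜 with rfl | rfl
    exacts [subset_rfl, posUpperDensity_subset]
  have hsum : ∀ (j : ℕ+) (s : Fin N), (∀ n, (S s).W j n ≠ 0) ∧
      Summable fun n => 1 / ‖(S s).W j n‖ ^ p.toReal := fun j s =>
    summable_of_visits (S s)
      (hBd (visits_mem hx (fun _ => lp.single p j 1) one_half_pos)) j fun n hn => hn s
  refine ⟨fun j s => (tsum_one_div_enorm_lt_top_iff hp0 (fun n => (S s).W j n)
    ((hsum j s).1 0)).2 (hsum j s), fun l a ha ε hε => ?_⟩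
  obtain ⟨α, β, hα, hβ, hab⟩ := exists_norm_bounds l ha
  -- The first bound serves (a), where `(min 1 ε) ^ p ≤ ε` because `p ≥ 1`; the second serves (b).
  obtain ⟨δ, hδ, hδ1, hδ2⟩ : ∃ δ : ℝ, 0 < δ ∧ δ ≤ α / 2 * min 1 ε ∧ 4 * δ * β ≤ ε * α ^ 2 := by
    refine ⟨min (α / 2 * min 1 ε) (ε * α ^ 2 / (4 * β)), by positivity, min_le_left _ _, ?_⟩
    have := min_le_right (α / 2 * min 1 ε) (ε * α ^ 2 / (4 * β))
    rw [le_div_iff₀ (by positivity)] at this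
    linarith
  have hδα : δ ≤ α / 2 := hδ1.trans (mul_le_of_le_one_right (by positivity) (min_le_left _ _))
  set y : Fin N → lp (fun _ : ℕ+ => 𝕜) p := fun s => finVec p (Finset.Icc 1 l) (a s)
  have hyle : ∀ s, ∀ j ≤ l, y s j = a s j := fun s j hj => by simp [y, finVec_apply, hj]
  have hygt : ∀ s, ∀ j > l, y s j = 0 := fun s j hj => by simp [y, finVec_apply, hj]
  set A := {n | ∀ s, ‖((S s).op p hp ^ n) x - y s‖ < δ}
  have hclose : ∀ n ∈ A, ∀ s, ∀ j ≤ l, ‖(S s).W j n * x ((S s).f^[n] j) - a s j‖ ≤ δ :=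
    fun n hn s j hj => by
      have h1 := (lp.norm_apply_le_norm hp0' (((S s).op p hp ^ n) x - y s) j).trans (hn s).le
      rwa [lp.coeFn_sub, Pi.sub_apply, (S s).op_pow_apply, hyle s j hj] at h1
  have hlow : ∀ n ∈ A, ∀ s, ∀ j ≤ l, α / 2 ≤ ‖(S s).W j n * x ((S s).f^[n] j)‖ :=
    fun n hn s j hj => by
      have h1 := hclose n hn s j hj
      have h2 := norm_sub_norm_le (a s j) ((S s).W j n * x ((S s).f^[n] j))
      rw [norm_sub_rev] at h2
      linarith [(hab s j hj).1]
  refine ⟨A, visits_mem hx y hδ, fun s t _ n hn => ⟨fun j hj => ?_, fun k hk => ?_⟩⟩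
  · rw [tsum_enorm_div_le_iff hp0.le
      (fun m => m ∈ A ∧ (S t).f^[m] j ∈ (S s).f^[n] '' Set.Ioi l)
      (fun m => (S s).W ((S s).fInv n ((S t).f^[m] j)) n) (fun m => (S t).W j m)
      (fun m => (hsum j t).1 m) hε.le]
    intro G hG
    set u := ((S s).op p hp ^ n) x - y s
    have hterm : ∀ m ∈ G, (α / 2) ^ p.toReal *
        (‖(S s).W ((S s).fInv n ((S t).f^[m] j)) n‖ ^ p.toReal / ‖(S t).W j m‖ ^ p.toReal) ≤
        ‖u ((S s).fInv n ((S t).f^[m] j))‖ ^ p.toReal := fun m hm => by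
      obtain ⟨hmA, hmr⟩ := hG m hm
      obtain ⟨hi1, hi2⟩ := (S s).fInv_mem_Ioi hmr
      have h0 : 0 < ‖(S t).W j m‖ := norm_pos_iff.2 ((hsum j t).1 m)
      have hu : u ((S s).fInv n ((S t).f^[m] j)) =
          (S s).W ((S s).fInv n ((S t).f^[m] j)) n * x ((S t).f^[m] j) := by
        simp only [u]
        rw [lp.coeFn_sub, Pi.sub_apply, (S s).op_pow_apply, hygt s _ hi1, sub_zero, hi2]
      have h1 := hlow m hmA t j hj
      rw [← Real.div_rpow (norm_nonneg _) h0.le, ← Real.mul_rpow (by positivity) (by positivity)]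
      refine Real.rpow_le_rpow (by positivity) ?_ hp0.le
      rw [← mul_div_assoc, div_le_iff₀ h0, hu, norm_mul]
      rw [norm_mul] at h1
      calc _ ≤ ‖(S t).W j m‖ * ‖x ((S t).f^[m] j)‖ *
            ‖(S s).W ((S s).fInv n ((S t).f^[m] j)) n‖ := by gcongr
        _ = _ := by ring
    have hinj : Set.InjOn (fun m => (S s).fInv n ((S t).f^[m] j)) (G : Set ℕ) :=
      fun m hm m' hm' h => by
        refine ((S t).iterate_strictMono j).injective ?_
        have h1 := ((S s).fInv_mem_Ioi (hG m hm).2).2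
        have h2 := ((S s).fInv_mem_Ioi (hG m' hm').2).2
        simp only at h ⊢
        rw [← h1, ← h2, h]
    have h3 : (α / 2) ^ p.toReal * ∑ m ∈ G,
        ‖(S s).W ((S s).fInv n ((S t).f^[m] j)) n‖ ^ p.toReal / ‖(S t).W j m‖ ^ p.toReal ≤
        (α / 2) ^ p.toReal * ε := by
      rw [Finset.mul_sum]
      refine (Finset.sum_le_sum hterm).trans ?_
      rw [← Finset.sum_image (f := fun k => ‖u k‖ ^ p.toReal) hinj]
      calc _ ≤ ‖u‖ ^ p.toReal := lp.sum_rpow_le_norm_rpow hp0 u _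
        _ ≤ (α / 2 * min 1 ε) ^ p.toReal :=
          Real.rpow_le_rpow (norm_nonneg _) ((hn s).le.trans hδ1) hp0.le
        _ = (α / 2) ^ p.toReal * (min 1 ε) ^ p.toReal :=
          Real.mul_rpow (by positivity) (by positivity)
        _ ≤ (α / 2) ^ p.toReal * ε := by
          gcongr
          calc (min 1 ε) ^ p.toReal ≤ (min 1 ε) ^ (1 : ℝ) :=
                Real.rpow_le_rpow_of_exponent_ge (by positivity) (min_le_left _ _) hp1
            _ ≤ ε := by rw [Real.rpow_one]; exact min_le_right _ _
    exact le_of_mul_le_mul_left h3 (by positivity)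
  · obtain ⟨ht1, ht2⟩ := (S t).fInv_mem_Iic hk.1
    obtain ⟨hs1, hs2⟩ := (S s).fInv_mem_Iic hk.2
    have h1 := hclose n hn s _ hs1
    have h2 := hclose n hn t _ ht1
    have h3 := hlow n hn s _ hs1
    rw [hs2] at h1 h3
    rw [ht2] at h2
    have hxk : x k ≠ 0 := fun h => by
      rw [h, mul_zero, norm_zero] at h3
      linarith
    -- Multiplying both weights by `x k` turns the quotient into one of two coordinates known
    -- approximately.
    rw [← mul_div_mul_right _ _ hxk]
    exact norm_div_sub_div_le hα h1 h2 (hab s _ hs1).2 (hab t _ ht1).1 (hab t _ ht1).2 hδα hδ2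

end Necessity

/-! ### Sufficiency -/

theorem mem_of_superset {𝒜 : Set (Set ℕ)}
    (h𝒜 : 𝒜 = posUpperBanachDensity ∨ 𝒜 = posUpperDensity) {A B : Set ℕ} (hA : A ∈ 𝒜)
    (hAB : A ⊆ B) : B ∈ 𝒜 := by
  obtain ⟨Blk, h1, h2⟩ := exists_block_criterion h𝒜
  obtain ⟨δ, hδ, h⟩ := h1 A hA
  refine h2 B δ hδ fun M => ?_
  obtain ⟨F, hFA, -, hF⟩ := h M
  exact ⟨M, le_rfl, F, hFA.trans hAB, hF⟩

theorem AlmostPartitionRegular.exists_gap {N : ℕ} {𝕜 : Type*} [RCLike 𝕜]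
    {S : Fin N → PseudoShift 𝕜} {𝒜 : Set (Set ℕ)}
    (hreg : AlmostPartitionRegular (fun s => (S s).f) 𝒜) (l : ℕ+) (M : ℕ) {B : Set ℕ}
    (hB : B ∈ 𝒜) (hN : 0 < N) : ∃ A ∈ 𝒜, A ⊆ B ∧
      (∀ m ∈ A, ∀ n ∈ A, m ≠ n → ∀ s t : Fin N,
        Disjoint ((S s).f^[m] '' Set.Iic l) ((S t).f^[n] '' Set.Iic l)) ∧
      ∀ m ∈ A, ∀ n ∈ A, n < m → M < m - n := by
  set s₀ : Fin N := ⟨0, hN⟩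
  -- If `0 < m - n ≤ M`, then `f^m(1) = f^n(f^(m-n)(1))` with `f^(m-n)(1) ≤ l'`, against separation
  -- at level `l'`.
  set l' := max l ((S s₀).f^[M] 1)
  obtain ⟨A, hA, hAB, hsep⟩ := hreg l' B hB
  refine ⟨A, hA, hAB, fun m hm n hn hmn s t => ?_, fun m hm n hn hnm => ?_⟩
  · exact (hsep m hm n hn hmn s t).mono (Set.image_mono (Set.Iic_subset_Iic.2 (le_max_left _ _)))
      (Set.image_mono (Set.Iic_subset_Iic.2 (le_max_left _ _)))
  · by_contra! hM
    refine Set.disjoint_left.1 (hsep m hm n hn hnm.ne' s₀ s₀)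
      (show (S s₀).f^[m] 1 ∈ (S s₀).f^[m] '' Set.Iic l' from ⟨1, Set.mem_Iic.2 one_le, rfl⟩) ⟨(S s₀).f^[m - n] 1, ?_, ?_⟩
    · exact (((S s₀).iterate_strictMono 1).monotone hM).trans (le_max_right _ _)
    · rw [← Function.iterate_add_apply, Nat.add_sub_cancel' hnm.le]

open Finset in
/-- A sum over positions is controlled by the sum over all labels of positions. -/
theorem sum_mul_rpow_le_sum_labels {E κ : Type*} [SeminormedAddGroup E] [DecidableEq κ] {q : ℝ}
    (hq : 0 < q) {ι : Type*} (I : Finset ι) (pos : ι → κ) (val : ι → E) (x : κ → E)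
    (hx : ∀ k, x k = 0 ∨ ∃ i ∈ I, pos i = k ∧ x k = val i) (c : κ → ℝ) (hc : ∀ k, 0 ≤ c k)
    (J : Finset κ) :
    ∑ k ∈ J, c k * ‖x k‖ ^ q ≤ ∑ i ∈ I with pos i ∈ J, c (pos i) * ‖val i‖ ^ q := by
  rw [← sum_fiberwise_of_maps_to (g := pos) (t := J) fun i hi => (mem_filter.1 hi).2]
  refine sum_le_sum fun k hk => ?_
  have hnn : ∀ i ∈ {i ∈ {i ∈ I | pos i ∈ J} | pos i = k}, 0 ≤ c (pos i) * ‖val i‖ ^ q :=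
    fun i _ => mul_nonneg (hc _) (by positivity)
  rcases hx k with h | ⟨i, hi, hik, h⟩
  · rw [h, norm_zero, Real.zero_rpow hq.ne', mul_zero]
    exact sum_nonneg hnn
  · rw [h, ← hik]
    rw [← hik] at hnn hk
    exact single_le_sum hnn (by simp [hi, hk])

section Sufficiency

variable {𝕜 : Type*} [RCLike 𝕜] {p : ℝ≥0∞} [Fact (1 ≤ p)] {hp : p ≠ ∞} {N : ℕ}
  {S : Fin N → PseudoShift 𝕜}

theorem exists_tail_le {q : ℝ} (hsum : ∀ s j, Summable fun n => 1 / ‖(S s).W j n‖ ^ q) (l : ℕ+)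
    {τ : ℝ} (hτ : 0 < τ) : ∃ M : ℕ, ∀ s, ∀ j ≤ l, ∀ F : Finset ℕ, (∀ m ∈ F, M < m) →
      ∑ m ∈ F, 1 / ‖(S s).W j m‖ ^ q ≤ τ := by
  have h : ∀ s j, ∃ M : ℕ, ∀ F : Finset ℕ, (∀ m ∈ F, M < m) →
      ∑ m ∈ F, 1 / ‖(S s).W j m‖ ^ q ≤ τ := fun s j => by
    obtain ⟨F₀, hF₀⟩ := summable_iff_vanishing_norm.1 (hsum s j) τ hτ
    refine ⟨F₀.sup id, fun F hF => (le_abs_self _).trans (hF₀ F ?_).le⟩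
    exact Finset.disjoint_left.2 fun m hm hm' =>
      absurd (hF m hm) (not_lt.2 (Finset.le_sup (f := id) hm'))
  choose M hM using h
  refine ⟨(Finset.univ ×ˢ Finset.Icc 1 l).sup fun r : Fin N × ℕ+ => M r.1 r.2,
    fun s j hj F hF => hM s j F fun m hm => lt_of_le_of_lt ?_ (hF m hm)⟩
  exact Finset.le_sup (f := fun r : Fin N × ℕ+ => M r.1 r.2) (b := (s, j)) (by simp [hj])

/-- The case `s = t`, which (2) leaves out. Here `j ≤ l` forces `m > n`, and the cocycle identity
`W_add` reduces each quotient to `1 / |W_{j,m-n}|^q`; the gaps exceed `M`, so a tail of (1) remains.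
-/
theorem sum_self_interaction_le (S : PseudoShift 𝕜) {q : ℝ} {l j : ℕ+} (hj : j ≤ l)
    (hW : ∀ j n, S.W j n ≠ 0) {M n : ℕ} {τ : ℝ}
    (hτ : ∀ F : Finset ℕ, (∀ m ∈ F, M < m) → ∑ m ∈ F, 1 / ‖S.W j m‖ ^ q ≤ τ)
    (G : Finset ℕ) (hgap : ∀ m ∈ G, n < m → M < m - n)
    (hG : ∀ m ∈ G, S.f^[m] j ∈ S.f^[n] '' Set.Ioi l) :
    ∑ m ∈ G, ‖S.W (S.fInv n (S.f^[m] j)) n‖ ^ q / ‖S.W j m‖ ^ q ≤ τ := by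
  have hlt : ∀ m ∈ G, n < m := fun m hm => by
    by_contra! hmn
    obtain ⟨i, hi, hij⟩ := hG m hm
    rw [← Nat.add_sub_cancel' hmn, Function.iterate_add_apply] at hij
    have h1 := S.iterate_injective m hij
    have h2 : i ≤ S.f^[n - m] i := (S.iterate_strictMono i).monotone (Nat.zero_le (n - m))
    exact absurd (h2.trans (h1.le.trans hj)) (not_le.2 hi)
  have hterm : ∀ m ∈ G, ‖S.W (S.fInv n (S.f^[m] j)) n‖ ^ q / ‖S.W j m‖ ^ q =
      1 / ‖S.W j (m - n)‖ ^ q := fun m hm => by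
    have hm' := (hlt m hm).le
    have h1 : S.fInv n (S.f^[m] j) = S.f^[m - n] j := by
      conv_lhs => rw [← Nat.add_sub_cancel' hm', Function.iterate_add_apply]
      exact S.fInv_iterate n _
    have h2 : S.W j m = S.W j (m - n) * S.W (S.f^[m - n] j) n := by
      rw [← S.W_add, Nat.sub_add_cancel hm']
    have h3 : 0 < ‖S.W (S.f^[m - n] j) n‖ := norm_pos_iff.2 (hW _ _)
    have h4 : 0 < ‖S.W j (m - n)‖ := norm_pos_iff.2 (hW _ _)
    rw [h1, h2, norm_mul, Real.mul_rpow h4.le h3.le]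
    field_simp
  rw [Finset.sum_congr rfl hterm, ← Finset.sum_image (f := fun g => 1 / ‖S.W j g‖ ^ q)
    (g := fun m => m - n) (s := G) fun m hm m' hm' h => by
      have h1 := hlt m hm
      have h2 := hlt m' hm'
      simp only at h
      omega]
  refine hτ _ fun g hg => ?_
  obtain ⟨m, hm, rfl⟩ := Finset.mem_image.1 hg
  exact hgap m hm (hlt m hm)

open Finset in
theorem exists_block_vector (hW : ∀ s j n, (S s).W j n ≠ 0) (l : ℕ+) (a : Fin N → ℕ+ → 𝕜)
    {β ε : ℝ} (hε : 0 < ε) (hε1 : ε ≤ 1) (hβ : 0 < β) (ha0 : ∀ s j, a s j ≠ 0)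
    (ha : ∀ s, ∀ j ≤ l, ‖a s j‖ ≤ β)
    {A : Set ℕ} (hsep : ∀ m ∈ A, ∀ n ∈ A, m ≠ n → ∀ s t : Fin N,
      Disjoint ((S s).f^[m] '' Set.Iic l) ((S t).f^[n] '' Set.Iic l))
    (hint : ∀ s t, ∀ n ∈ A, ∀ j ≤ l, ∀ G : Finset ℕ,
      (∀ m ∈ G, m ∈ A ∧ (S t).f^[m] j ∈ (S s).f^[n] '' Set.Ioi l) →
      ∑ m ∈ G, ‖(S s).W ((S s).fInv n ((S t).f^[m] j)) n‖ ^ p.toReal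
        / ‖(S t).W j m‖ ^ p.toReal ≤ ε)
    (hrat : ∀ s t, s ≠ t → ∀ n ∈ A, ∀ i ≤ l, ∀ j ≤ l, (S s).f^[n] i = (S t).f^[n] j →
      ‖(S s).W i n / (S t).W j n - a s i / a t j‖ ≤ ε)
    (F : Finset ℕ) (hF : ↑F ⊆ A) :
    ∃ x : lp (fun _ : ℕ+ => 𝕜) p, (∃ M : ℕ, ∀ k : ℕ+, M ≤ (k : ℕ) → x k = 0) ∧
      (∀ τ C : ℝ, 0 ≤ C → (∀ s, ∀ j ≤ l, ∑ m ∈ F, 1 / ‖(S s).W j m‖ ^ p.toReal ≤ τ) →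
        N * l * (β ^ p.toReal * τ) ≤ C ^ p.toReal → ‖x‖ ≤ C) ∧
      ∀ C : ℝ, 0 ≤ C → (l + N * l) * (β ^ p.toReal * ε) ≤ C ^ p.toReal → ∀ n ∈ F, ∀ s,
        ‖((S s).op p hp ^ n) x - finVec p (Icc 1 l) (a s)‖ ≤ C := by
  have hp1 : 1 ≤ p.toReal := (ENNReal.dichotomy p).resolve_left hp
  have hp0 : 0 < p.toReal := one_pos.trans_le hp1
  set q := p.toReal
  set I : Finset (Fin N × ℕ+ × ℕ) := univ ×ˢ Icc 1 l ×ˢ F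
  set pos : Fin N × ℕ+ × ℕ → ℕ+ := fun r => (S r.1).f^[r.2.2] r.2.1
  set val : Fin N × ℕ+ × ℕ → 𝕜 := fun r => a r.1 r.2.1 / (S r.1).W r.2.1 r.2.2
  have hI : ∀ r, r ∈ I ↔ r.2.1 ≤ l ∧ r.2.2 ∈ F := fun r => by simp [I]
  have hval : ∀ r ∈ I, ‖val r‖ ^ q ≤ β ^ q * (1 / ‖(S r.1).W r.2.1 r.2.2‖ ^ q) := fun r hr => by
    simp only [val]
    rw [norm_div, Real.div_rpow (norm_nonneg _) (norm_nonneg _), mul_one_div]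
    gcongr
    exact ha _ _ ((hI r).1 hr).1
  -- Several labels may share a position; an arbitrary one of them supplies the value there.
  have hrep : ∀ k, ∃ v : 𝕜, k ∈ I.image pos → ∃ r ∈ I, pos r = k ∧ v = val r := fun k => by
    by_cases hk : k ∈ I.image pos
    · obtain ⟨r, hr, hrk⟩ := mem_image.1 hk
      exact ⟨val r, fun _ => ⟨r, hr, hrk, rfl⟩⟩
    · exact ⟨0, fun h => absurd h hk⟩
  choose g hg using hrep
  set x : lp (fun _ : ℕ+ => 𝕜) p := finVec p (I.image pos) g
  have hxmem : ∀ k ∈ I.image pos, ∃ r ∈ I, pos r = k ∧ x k = val r := fun k hk => by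
    simp only [x]
    rw [finVec_apply, if_pos hk]
    exact hg k hk
  have hxnot : ∀ k ∉ I.image pos, x k = 0 := fun k hk => by
    simp only [x]
    rw [finVec_apply, if_neg hk]
  have hx : ∀ k, x k = 0 ∨ ∃ r ∈ I, pos r = k ∧ x k = val r := fun k => by
    by_cases hk : k ∈ I.image pos
    · exact Or.inr (hxmem k hk)
    · exact Or.inl (hxnot k hk)
  refine ⟨x, ?_, fun τ C hC hτ hτC => ?_, fun C hC hεC n hn s => ?_⟩
  · refine ⟨(I.image pos).sup (fun k : ℕ+ => (k : ℕ)) + 1, fun k hk => hxnot k fun hk' => ?_⟩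
    have := le_sup (f := fun k : ℕ+ => (k : ℕ)) hk'
    omega
  · refine lp.norm_le_of_forall_sum_le hp0 hC fun J => le_trans ?_ hτC
    have h1 := sum_mul_rpow_le_sum_labels hp0 I pos val x hx (fun _ => 1)
      (fun _ => zero_le_one) J
    simp only [one_mul] at h1
    refine h1.trans ((sum_le_sum_of_subset_of_nonneg (filter_subset _ _)
      fun _ _ _ => by positivity).trans ((sum_le_sum hval).trans ?_))
    simp only [I, sum_product]
    calc _ ≤ ∑ t : Fin N, ∑ j ∈ Icc 1 l, β ^ q * τ := by
          refine sum_le_sum fun t _ => sum_le_sum fun j hj => ?_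
          rw [← mul_sum]
          gcongr
          exact hτ t j (mem_Icc.1 hj).2
      _ = N * l * (β ^ q * τ) := by simp [mul_assoc]
  · have hnA : n ∈ A := hF hn
    have hsmall : ∀ i ≤ l, ‖(S s).W i n * x ((S s).f^[n] i) - a s i‖ ^ q ≤ β ^ q * ε :=
      fun i hi => by
        have hk : (S s).f^[n] i ∈ I.image pos :=
          mem_image.2 ⟨(s, i, n), (hI _).2 ⟨hi, hn⟩, rfl⟩
        obtain ⟨⟨t, j, m⟩, hr, hpos, hxv⟩ := hxmem _ hk
        obtain ⟨hj, hm⟩ := (hI _).1 hr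
        simp only [pos] at hpos
        simp only at hj hm
        -- By separation, labels sharing a position with level at most `l` have the same time, so
        -- only `hrat` is needed to compare them.
        have hmn : m = n := by
          by_contra hmn
          exact Set.disjoint_left.1 (hsep m (hF hm) n hnA hmn t s) ⟨j, hj, rfl⟩ ⟨i, hi, hpos.symm⟩
        subst hmn
        have hle : ‖(S s).W i m * x ((S s).f^[m] i) - a s i‖ ≤ β * ε := by
          rw [hxv]
          simp only [val]
          have hWt := hW t j m
          have hat := ha0 t j
          by_cases hst : s = t
          · subst hst
            have hij := (S s).iterate_injective m hpos
            subst hij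
            rw [mul_div_cancel₀ _ hWt, sub_self, norm_zero]
            positivity
          · have h1 := hrat s t hst m hnA i hi j hj hpos.symm
            have h2 : (S s).W i m * (a t j / (S t).W j m) - a s i =
                a t j * ((S s).W i m / (S t).W j m - a s i / a t j) := by
              field_simp
            rw [h2, norm_mul]
            exact mul_le_mul (ha t j hj) h1 (norm_nonneg _) hβ.le
        calc _ ≤ (β * ε) ^ q := Real.rpow_le_rpow (norm_nonneg _) hle hp0.le
          _ = β ^ q * ε ^ q := Real.mul_rpow hβ.le hε.le
          _ ≤ β ^ q * ε := by
            gcongr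
            calc ε ^ q ≤ ε ^ (1 : ℝ) := Real.rpow_le_rpow_of_exponent_ge hε hε1 hp1
              _ = ε := Real.rpow_one ε
    refine lp.norm_le_of_forall_sum_le hp0 hC fun J => le_trans ?_ hεC
    have hcoord : ∀ i, (((S s).op p hp ^ n) x - finVec p (Icc 1 l) (a s)) i =
        (S s).W i n * x ((S s).f^[n] i) - if i ≤ l then a s i else 0 := fun i => by
      rw [lp.coeFn_sub, Pi.sub_apply, (S s).op_pow_apply]
      congr 1
      rw [finVec_apply]
      simp
    simp only [hcoord]
    -- Coordinates up to `l` are errors in hitting the target; those beyond `l` are interaction sums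
    -- bounded by `hint`.
    rw [← sum_filter_add_sum_filter_not J (· ≤ l), add_mul]
    refine add_le_add ?_ ?_
    · calc _ ≤ ∑ i ∈ J with i ≤ l, β ^ q * ε := by
            refine sum_le_sum fun i hi => ?_
            have hi' := (mem_filter.1 hi).2
            rw [if_pos hi']
            exact hsmall i hi'
        _ = #{i ∈ J | i ≤ l} * (β ^ q * ε) := by simp
        _ ≤ l * (β ^ q * ε) := by
            gcongr
            calc #{i ∈ J | i ≤ l} ≤ #(Icc 1 l) :=
                  card_le_card fun i hi => by simpa using (mem_filter.1 hi).2
              _ = l := by simp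
    · set J' := {i ∈ J | ¬ i ≤ l}.image ((S s).f^[n])
      have hJ' : ∀ k ∈ J', k ∈ (S s).f^[n] '' Set.Ioi l := fun k hk => by
        obtain ⟨i, hi, rfl⟩ := mem_image.1 hk
        exact ⟨i, not_le.1 (mem_filter.1 hi).2, rfl⟩
      have h1 := sum_mul_rpow_le_sum_labels hp0 I pos val x hx
        (fun k => ‖(S s).W ((S s).fInv n k) n‖ ^ q) (fun _ => by positivity) J'
      calc _ = ∑ k ∈ J', ‖(S s).W ((S s).fInv n k) n‖ ^ q * ‖x k‖ ^ q := by
            rw [sum_image ((S s).iterate_injective n).injOn]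
            refine sum_congr rfl fun i hi => ?_
            rw [if_neg (mem_filter.1 hi).2, sub_zero, (S s).fInv_iterate, norm_mul,
              Real.mul_rpow (norm_nonneg _) (norm_nonneg _)]
        _ ≤ _ := h1
        _ = ∑ t : Fin N, ∑ j ∈ Icc 1 l, ∑ m ∈ F with (S t).f^[m] j ∈ J',
              ‖(S s).W ((S s).fInv n ((S t).f^[m] j)) n‖ ^ q * ‖val (t, j, m)‖ ^ q := by
            simp only [sum_filter, I, sum_product, pos]
        _ ≤ ∑ t : Fin N, ∑ j ∈ Icc 1 l, β ^ q * ε := by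
            refine sum_le_sum fun t _ => sum_le_sum fun j hj => ?_
            have hj' := (mem_Icc.1 hj).2
            calc _ ≤ ∑ m ∈ F with (S t).f^[m] j ∈ J', β ^ q *
                  (‖(S s).W ((S s).fInv n ((S t).f^[m] j)) n‖ ^ q / ‖(S t).W j m‖ ^ q) := by
                  refine sum_le_sum fun m hm => ?_
                  have := hval (t, j, m) ((hI _).2 ⟨hj', (mem_filter.1 hm).1⟩)
                  calc _ ≤ ‖(S s).W ((S s).fInv n ((S t).f^[m] j)) n‖ ^ q *
                        (β ^ q * (1 / ‖(S t).W j m‖ ^ q)) := by gcongr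
                    _ = _ := by ring
              _ ≤ β ^ q * ε := by
                  rw [← mul_sum]
                  gcongr
                  refine hint s t n hnA j hj' _ fun m hm => ?_
                  obtain ⟨hm1, hm2⟩ := mem_filter.1 hm
                  exact ⟨hF hm1, hJ' _ hm2⟩
        _ = N * l * (β ^ q * ε) := by simp [mul_assoc]

end Sufficiency

/-! ### A countable family of targets -/

section Targets

variable {𝕜 : Type*} [RCLike 𝕜] {p : ℝ≥0∞} [Fact (1 ≤ p)] {N : ℕ}

theorem continuous_finVec (l : ℕ+) :
    Continuous fun (a : Fin N → ℕ+ → 𝕜) (s : Fin N) => finVec p (Finset.Icc 1 l) (a s) := by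
  refine continuous_pi fun s => continuous_finsetSum _ fun k _ => ?_
  exact (lp.isometry_single (E := fun _ : ℕ+ => 𝕜) k).continuous.comp
    ((continuous_apply k).comp (continuous_apply s))

theorem exists_finVec_mem (hp : p ≠ ∞) {U : Set (Fin N → lp (fun _ : ℕ+ => 𝕜) p)}
    (hU : IsOpen U) (hne : U.Nonempty) :
    ∃ (l : ℕ) (u : Fin N → ℕ+ → 𝕜),
      (fun s => finVec p (Finset.Icc 1 l.succPNat) (u s)) ∈ U := by
  obtain ⟨u, hu⟩ := hne
  have hIcc : Filter.Tendsto (fun l : ℕ => Finset.Icc 1 l.succPNat) Filter.atTop Filter.atTop := by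
    refine Filter.tendsto_atTop_finset_of_monotone (fun l l' hl => ?_) fun k => ⟨k.natPred, ?_⟩
    · exact Finset.Icc_subset_Icc_right (Nat.succPNat_mono hl)
    · simp
  have hlim : Filter.Tendsto (fun (l : ℕ) (s : Fin N) =>
      finVec p (Finset.Icc 1 l.succPNat) (u s)) Filter.atTop (nhds u) :=
    tendsto_pi_nhds.2 fun s => by
      have := lp.hasSum_single hp (u s)
      rw [HasSum, SummationFilter.unconditional_filter] at this
      exact this.comp hIcc
  obtain ⟨l, hl⟩ := (hlim.eventually (hU.mem_nhds hu)).exists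
  exact ⟨l, fun s => u s, hl⟩

/-- Countably many finitely supported targets with nonzero coefficients suffice. -/
theorem exists_dense_coefficients (hp : p ≠ ∞) :
    ∃ D : ℕ → Fin N → ℕ+ → 𝕜, (∀ i s j, D i s j ≠ 0) ∧
      ∀ U : Set (Fin N → lp (fun _ : ℕ+ => 𝕜) p), IsOpen U → U.Nonempty →
        ∃ l i : ℕ, (fun s => finVec p (Finset.Icc 1 l.succPNat) (D i s)) ∈ U := by
  set Z : Set (Fin N → ℕ+ → 𝕜) :=
    Set.pi Set.univ fun _ => Set.pi Set.univ fun _ => ({0} : Set 𝕜)ᶜ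
  -- Condition (2) only concerns nonzero coefficients; these families are dense in the product
  -- topology, and `finVec` is continuous for it.
  have hZ : Dense Z := dense_pi _ fun _ _ => dense_pi _ fun _ _ => dense_compl_singleton 0
  have : Nonempty Z := ⟨⟨fun _ _ => 1, fun _ _ _ _ => one_ne_zero⟩⟩
  refine ⟨fun i => (TopologicalSpace.denseSeq Z i : Fin N → ℕ+ → 𝕜), fun i s j =>
    (TopologicalSpace.denseSeq Z i).2 s trivial j trivial, fun U hU hne => ?_⟩
  obtain ⟨l, u, hu⟩ := exists_finVec_mem hp hU hne
  have hV := hU.preimage (continuous_finVec (𝕜 := 𝕜) (p := p) (N := N) l.succPNat)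
  obtain ⟨v, hvV, hvZ⟩ := hZ.inter_open_nonempty _ hV ⟨u, hu⟩
  obtain ⟨i, hi⟩ := (TopologicalSpace.denseRange_denseSeq Z).exists_mem_open
    (hV.preimage continuous_subtype_val) ⟨⟨v, hvZ⟩, hvV⟩
  exact ⟨l, i, hi⟩

end Targets

/-! ### From the two conditions to a hypercyclic vector -/

section Sufficiency

variable {𝕜 : Type*} [RCLike 𝕜] {p : ℝ≥0∞} [Fact (1 ≤ p)] {hp : p ≠ ∞} {N : ℕ}
  {S : Fin N → PseudoShift 𝕜} {𝒜 : Set (Set ℕ)}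

theorem exists_steering (hN : 0 < N) (hreg : AlmostPartitionRegular (fun s => (S s).f) 𝒜)
    (hW : ∀ s j n, (S s).W j n ≠ 0)
    (hsum : ∀ s j, Summable fun n => 1 / ‖(S s).W j n‖ ^ p.toReal)
    (l : ℕ+) (a : Fin N → ℕ+ → 𝕜) (ha : ∀ s j, a s j ≠ 0)
    (h : ∀ ε : ℝ, 0 < ε → ∃ A ∈ 𝒜, ∀ s t : Fin N, s ≠ t → ∀ n ∈ A,
          (∀ j ∈ Set.Iic l,
            ∑' m : {m : ℕ // m ∈ A ∧ (S t).f^[m] j ∈ (S s).f^[n] '' Set.Ioi l},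
              ‖(S s).W ((S s).fInv n ((S t).f^[m] j)) n‖ₑ ^ p.toReal
                / ‖(S t).W j m‖ₑ ^ p.toReal ≤ ENNReal.ofReal ε) ∧
          (∀ k ∈ ((S t).f^[n] '' Set.Iic l) ∩ ((S s).f^[n] '' Set.Iic l),
            ‖(S s).W ((S s).fInv n k) n / (S t).W ((S t).fInv n k) n
              - a s ((S s).fInv n k) / a t ((S t).fInv n k)‖ ≤ ε))
    {η : ℝ} (hη : 0 < η) :
    ∃ A ∈ 𝒜, ∀ ε > 0, ∃ M, ∀ F : Finset ℕ, ↑F ⊆ A → (∀ n ∈ F, M < n) →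
      ∃ x ∈ {x : lp (fun _ : ℕ+ => 𝕜) p | ∃ M : ℕ, ∀ k : ℕ+, M ≤ (k : ℕ) → x k = 0},
        ‖x‖ ≤ ε ∧ ∀ n ∈ F, ∀ s,
          ‖((S s).op p hp ^ n) x - finVec p (Finset.Icc 1 l) (a s)‖ ≤ η := by
  have hp0 : 0 < p.toReal :=
    one_pos.trans_le ((ENNReal.dichotomy p).resolve_left hp)
  obtain ⟨α, β, -, hβ, hab⟩ := exists_norm_bounds l fun s j _ => ha s j
  have hl : (0 : ℝ) < l := by exact_mod_cast l.pos
  obtain ⟨τ, hτ, hτ1, hτη⟩ : ∃ τ : ℝ, 0 < τ ∧ τ ≤ 1 ∧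
      (l + N * l) * (β ^ p.toReal * τ) ≤ η ^ p.toReal := by
    have hc : 0 < (l + N * l : ℝ) * β ^ p.toReal := by positivity
    refine ⟨min 1 (η ^ p.toReal / ((l + N * l) * β ^ p.toReal)), by positivity,
      min_le_left _ _, ?_⟩
    have := min_le_right 1 (η ^ p.toReal / ((l + N * l : ℝ) * β ^ p.toReal))
    rw [le_div_iff₀ hc] at this
    linarith
  obtain ⟨B, hB, hBc⟩ := h τ hτ
  obtain ⟨M, hM⟩ := exists_tail_le hsum l hτ
  obtain ⟨A, hA, hAB, hsep, hgap⟩ := hreg.exists_gap l M hB hN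
  refine ⟨A, hA, fun ε hε => ?_⟩
  -- `A` was fixed by the accuracy `η` alone; the norm bound `ε` only affects how far out `F` must
  -- start.
  obtain ⟨M', hM'⟩ := exists_tail_le hsum l
    (τ := ε ^ p.toReal / ((N * l) * β ^ p.toReal)) (by positivity)
  refine ⟨M', fun F hFA hF => ?_⟩
  obtain ⟨x, hx1, hx2, hx3⟩ := exists_block_vector (p := p) (hp := hp) hW l a hτ hτ1 hβ ha
    (fun s j hj => (hab s j hj).2) hsep
    (fun s t n hn j hj G hG => by
      by_cases hst : s = t
      · subst hst
        exact sum_self_interaction_le (S s) hj (hW s) (hM s j hj) G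
          (fun m hm hnm => hgap m (hG m hm).1 n hn hnm) fun m hm => (hG m hm).2
      · exact (tsum_enorm_div_le_iff hp0.le
          (fun m => m ∈ B ∧ (S t).f^[m] j ∈ (S s).f^[n] '' Set.Ioi l)
          (fun m => (S s).W ((S s).fInv n ((S t).f^[m] j)) n) (fun m => (S t).W j m)
          (hW t j) hτ.le).1 ((hBc s t hst n (hAB hn)).1 j hj) G
          fun m hm => ⟨hAB (hG m hm).1, (hG m hm).2⟩)
    (fun s t hst n hn i hi j hj hij => by
      have h1 := (hBc s t hst n (hAB hn)).2 ((S s).f^[n] i) ⟨⟨j, hj, hij.symm⟩, ⟨i, hi, rfl⟩⟩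
      rw [(S s).fInv_iterate] at h1
      rwa [hij, (S t).fInv_iterate] at h1) F hFA
  refine ⟨x, hx1, hx2 _ ε hε.le (fun s j hj => hM' s j hj F hF) (le_of_eq ?_), hx3 η hη.le hτη⟩
  have : (0 : ℝ) < N := by exact_mod_cast hN
  field_simp

theorem disjointHypercyclic_of_conditions
    (h𝒜 : 𝒜 = posUpperBanachDensity ∨ 𝒜 = posUpperDensity) (hN : 0 < N)
    (hreg : AlmostPartitionRegular (fun s => (S s).f) 𝒜)
    (h1 : ∀ (j : ℕ+) (s : Fin N), ∑' n : ℕ+, 1 / ‖(S s).W j n‖ₑ ^ p.toReal < ∞)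
    (h2 : ∀ (l : ℕ+) (a : Fin N → ℕ+ → 𝕜), (∀ s, ∀ j ∈ Set.Iic l, a s j ≠ 0) →
        ∀ ε : ℝ, 0 < ε → ∃ A ∈ 𝒜, ∀ s t : Fin N, s ≠ t → ∀ n ∈ A,
          (∀ j ∈ Set.Iic l,
            ∑' m : {m : ℕ // m ∈ A ∧ (S t).f^[m] j ∈ (S s).f^[n] '' Set.Ioi l},
              ‖(S s).W ((S s).fInv n ((S t).f^[m] j)) n‖ₑ ^ p.toReal
                / ‖(S t).W j m‖ₑ ^ p.toReal ≤ ENNReal.ofReal ε) ∧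
          (∀ k ∈ ((S t).f^[n] '' Set.Iic l) ∩ ((S s).f^[n] '' Set.Iic l),
            ‖(S s).W ((S s).fInv n k) n / (S t).W ((S t).fInv n k) n
              - a s ((S s).fInv n k) / a t ((S t).fInv n k)‖ ≤ ε)) :
    DisjointHypercyclic 𝒜 (fun s => (S s).op p hp) := by
  have hp0 : 0 < p.toReal :=
    one_pos.trans_le ((ENNReal.dichotomy p).resolve_left hp)
  have hWs : ∀ s j, (∀ n, (S s).W j n ≠ 0) ∧
      Summable fun n => 1 / ‖(S s).W j n‖ ^ p.toReal := fun s j =>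
    (tsum_one_div_enorm_lt_top_iff hp0 (fun n => (S s).W j n)
      (by rw [(S s).W_zero]; exact one_ne_zero)).1 (h1 j s)
  obtain ⟨D, hD0, hD⟩ := exists_dense_coefficients (𝕜 := 𝕜) (N := N) hp
  -- The index `r` encodes length, coefficients and a free third number; the last makes the same
  -- target recur with accuracy `1 / (r + 1)` as small as desired.
  set L : ℕ → ℕ+ := fun r => (r.unpair.1.unpair.1).succPNat
  set a : ℕ → Fin N → ℕ+ → 𝕜 := fun r => D r.unpair.1.unpair.2
  obtain ⟨x, hx⟩ := exists_common_orbit h𝒜 (fun s => (S s).op p hp)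
    {x : lp (fun _ : ℕ+ => 𝕜) p | ∃ M : ℕ, ∀ k : ℕ+, M ≤ (k : ℕ) → x k = 0}
    (fun x ⟨M, hM⟩ => ⟨M, fun n hn s => by
      ext j
      rw [(S s).op_pow_apply, hM _ (hn.trans ((S s).lt_iterate n j).le), mul_zero]
      rfl⟩)
    (fun r s => finVec p (Finset.Icc 1 (L r)) (a r s)) (fun r => 1 / ((r : ℝ) + 1))
    (fun r => by positivity)
    (fun r r' hr => by
      have : (r : ℝ) ≤ r' := by exact_mod_cast hr
      exact one_div_le_one_div_of_le (by positivity) (by linarith))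
    (fun r => exists_steering hN hreg (fun s j => (hWs s j).1) (fun s j => (hWs s j).2) (L r) (a r)
      (hD0 _) (h2 (L r) (a r) fun s j _ => hD0 _ s j) (by positivity))
  refine ⟨x, fun U hU hne => ?_⟩
  obtain ⟨l, i, hi⟩ := hD U hU hne
  obtain ⟨ρ, hρ, hball⟩ := Metric.isOpen_iff.1 hU _ hi
  obtain ⟨k, hk⟩ := exists_nat_one_div_lt (half_pos hρ)
  refine mem_of_superset h𝒜 (hx (Nat.pair (Nat.pair l i) k)) fun n hn => hball ?_
  rw [Metric.mem_ball, dist_pi_lt_iff hρ]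
  intro s
  rw [piMap_pow_apply, dist_eq_norm]
  have h3 := hn s
  simp only [L, a, Nat.unpair_pair] at h3
  refine h3.trans_lt ?_
  have h4 : (k : ℝ) ≤ Nat.pair (Nat.pair l i) k := by exact_mod_cast Nat.right_le_pair _ _
  have h5 : 1 / ((Nat.pair (Nat.pair l i) k : ℝ) + 1) ≤ 1 / ((k : ℝ) + 1) :=
    one_div_le_one_div_of_le (by positivity) (by linarith)
  linarith

end Sufficiency

end DisjointDynamics

theorem mainTheorem7 {𝕜 : Type*} [RCLike 𝕜] (p : ℝ≥0∞) [Fact (1 ≤ p)] (hp : p ≠ ∞)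
    {N : ℕ} (hN : 2 ≤ N) (S : Fin N → PseudoShift 𝕜)
    (𝒜 : Set (Set ℕ)) (h𝒜 : 𝒜 = posUpperBanachDensity ∨ 𝒜 = posUpperDensity)
    (hreg : AlmostPartitionRegular (fun s => (S s).f) 𝒜) :
    DisjointHypercyclic 𝒜 (fun s => (S s).op p hp) ↔
      -- sums in `[0, ∞]`, with `1 / 0 = ∞`
      (∀ (j : ℕ+) (s : Fin N), ∑' n : ℕ+, 1 / ‖(S s).W j n‖ₑ ^ p.toReal < ∞) ∧
      (∀ (l : ℕ+) (a : Fin N → ℕ+ → 𝕜), (∀ s, ∀ j ∈ Set.Iic l, a s j ≠ 0) →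
        ∀ ε : ℝ, 0 < ε → ∃ A ∈ 𝒜, ∀ s t : Fin N, s ≠ t → ∀ n ∈ A,
          (∀ j ∈ Set.Iic l,
            ∑' m : {m : ℕ // m ∈ A ∧ (S t).f^[m] j ∈ (S s).f^[n] '' Set.Ioi l},
              ‖(S s).W ((S s).fInv n ((S t).f^[m] j)) n‖ₑ ^ p.toReal
                / ‖(S t).W j m‖ₑ ^ p.toReal ≤ ENNReal.ofReal ε) ∧
          (∀ k ∈ ((S t).f^[n] '' Set.Iic l) ∩ ((S s).f^[n] '' Set.Iic l),
            ‖(S s).W ((S s).fInv n k) n / (S t).W ((S t).fInv n k) n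
              - a s ((S s).fInv n k) / a t ((S t).fInv n k)‖ ≤ ε)) := by
  constructor
  · rintro ⟨x, hx⟩
    exact conditions_of_disjointHypercyclic h𝒜 hx
  · rintro ⟨h1, h2⟩
    exact disjointHypercyclic_of_conditions h𝒜 (by omega) hreg h1 h2
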